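/- Let $\Lambda$ be a finite-dimensional algebra over a field $k$ and $\mathcal P(\Lambda)$ the category of finitely generated projective right $\Lambda$-modules. For an interval $J\subseteq\mathbb Z$ let $\mathcal K^J_{\mathcal I}(\mathcal P(\Lambda))$ be the full subcategory of the homotopy category $\mathcal K(\mathcal P(\Lambda))$ of complexes over $\mathcal P(\Lambda)$ whose objects are the minimal projective complexes $X=(X^i,d^i)$ (that is, $\operatorname{Im} d^i\subseteq \operatorname{rad} X^{i+1}$ for all $i$) with $X^i=0$ for $i\notin J$. A morphism is *irreducible* if it is neither a split monomorphism nor a split epimorphism and, whenever it factors as $hg$, $h$ is a split epimorphism or $g$ is a split monomorphism. A chain map $f=(f^i)$ is *smonic* (*sepic*) if every $f^i$ is a split monomorphism (split epimorphism), and *sirreducible* if there is exactly one index $i_0$ with $f^{i_0}$ irreducible in $\mathcal P(\Lambda)$, $f^i$ is a split epimorphism for $i<i_0$ and $f^i$ is a split monomorphism for $i>i_0$. Distinguished triangles in $\mathcal K(\mathcal P(\Lambda))$ are those isomorphic to some $X\xrightarrow{f}Y\to C_f\to X[1]$, where $C_f^n=X^{n+1}\oplus Y^n$ has differential $(x,y)\mapsto(-dx,fx+dy)$,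 the last two maps are the inclusion and the projection, and $d_{X[1]}=-d_X$. An *Auslander-Reiten triangle in $\mathcal K^J_{\mathcal I}(\mathcal P(\Lambda))$* is a distinguished triangle $X\xrightarrow{u}Y\xrightarrow{v}Z\xrightarrow{w}X[1]$ with $X,Y,Z\in\mathcal K^J_{\mathcal I}(\mathcal P(\Lambda))$, with $X,Z$ indecomposable, with $w\neq0$, and such that every $f:W\to Z$ in $\mathcal K^J_{\mathcal I}(\mathcal P(\Lambda))$ that is not a split epimorphism factors through $v$. Let $(*)\ X\xrightarrow{u}Y\xrightarrow{v}Z\xrightarrow{w}X[1]$ be such a triangle, with $u,v,w$ represented by chain maps. Isomorphisms of triangles below are in the homotopy category, and the objects of the explicit triangles lie in $\mathcal K^J_{\mathcal I}(\mathcal P(\Lambda))$. (a) If $u$ is smonic, then $v$ is sepic and $(*)$ is isomorphic to a triangle $$(X^n,d)\xrightarrow{\binom10}\Bigl(X^n\oplus Y'^n,\begin{pmatrix}d&a\\0&e\end{pmatrix}\Bigr)\xrightarrow{(0\ 1)}(Y'^n,e)\xrightarrow{-a}X[1].$$ For (b) and (c), let $A,E,B$ be graded objects of $\mathcal P(\Lambda)$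 with morphisms $\alpha^n:A^n\to A^{n+1}$, $e^n:E^n\to E^{n+1}$, $\beta^n:B^n\to B^{n+1}$, $b^n:A^n\to E^{n+1}$, $f^n:E^n\to B^n$ satisfying $\alpha\alpha=0$, $ee=0$, $\beta\beta=0$, $b\alpha+eb=0$, $\beta f=fe$, and let $T(A,E,B)$ be the triangle $$\Bigl(A^n\oplus E^n,\begin{pmatrix}\alpha&0\\b&e\end{pmatrix}\Bigr)\xrightarrow{\begin{pmatrix}1&0\\0&f\end{pmatrix}}\Bigl(A^n\oplus B^n,\begin{pmatrix}\alpha&0\\fb&\beta\end{pmatrix}\Bigr)\xrightarrow{\begin{pmatrix}b&0\\0&1\end{pmatrix}}\Bigl(E^{n+1}\oplus B^n,\begin{pmatrix}-e&0\\f&\beta\end{pmatrix}\Bigr)\xrightarrow{\begin{pmatrix}0&0\\1&0\end{pmatrix}}(A\oplus E)[1].$$ (b) If $u$ is sepic, and either $Y\not\cong0$ or $\Lambda$ has no nonzero semisimple ring direct factor, then $v$ is sirreducible and, for some $i$, $(*)$ is isomorphic to some $T(A,E,B)$ with $B=0$, $A^n=0$ for $n>i$, $E^n=0$ for $n\le i$,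 and $b^i:A^i\to E^{i+1}$ irreducible in $\mathcal P(\Lambda)$. (c) If $u$ is sirreducible, then one of the following holds for some $i$. (1) $v$ is smonic and $(*)$ is isomorphic to some $T(A,E,B)$ with $A=0$, $E^n=0$ for $n>i$, $B^n=0$ for $n<i$, and $f^i$ irreducible in $\mathcal P(\Lambda)$. (2) $v$ is sirreducible and, for some $j\le i-2$, $(*)$ is isomorphic to some $T(A,E,B)$ with $A^n=0$ for $n>j$, $E^n=0$ unless $j<n\le i$, $B^n=0$ for $n<i$, and $f^i$ and $b^j:A^j\to E^{j+1}$ irreducible in $\mathcal P(\Lambda)$. (3) $v$ is sirreducible and $(*)$ is isomorphic to some $T(A,E,B)$ with $A^n=0$ for $n>i-1$, $E^n=0$ for $n\neq i$, $B^n=0$ for $n<i$, and $f^i$ and $b^{i-1}:A^{i-1}\to E^i$ irreducible in $\mathcal P(\Lambda)$. -/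

import Mathlib

open CategoryTheory CategoryTheory.Limits CategoryTheory.Pretriangulated

universe u

noncomputable section

namespace ARTriangles

/-! ## Irreducible, smonic, sepic and sirreducible morphisms -/

section General

variable {C : Type*} [Category C]

/-- A morphism is irreducible if it is neither a split monomorphism nor a split epimorphism and in
every factorization through an object of the category, the first factor is a split monomorphism or
the second factor is a split epimorphism. -/
def IsIrreducibleMor {X Y : C} (f : X ⟶ Y) : Prop :=
  ¬ IsSplitMono f ∧ ¬ IsSplitEpi f ∧
    ∀ (W : C) (g : X ⟶ W) (h : W ⟶ Y), g ≫ h = f → IsSplitMono g ∨ IsSplitEpi h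

variable [HasZeroMorphisms C] {X Y : CochainComplex C ℤ}

/-- All components are split monomorphisms. -/
def IsSmonic (f : X ⟶ Y) : Prop := ∀ i : ℤ, IsSplitMono (f.f i)

/-- All components are split epimorphisms. -/
def IsSepic (f : X ⟶ Y) : Prop := ∀ i : ℤ, IsSplitEpi (f.f i)

/-- There is exactly one index `i₀` for which the component is irreducible; the components are split
epimorphisms below `i₀` and split monomorphisms above `i₀`. -/
def IsSirreducible (f : X ⟶ Y) : Prop :=
  ∃ i₀ : ℤ, IsIrreducibleMor (f.f i₀) ∧ (∀ i, IsIrreducibleMor (f.f i) → i = i₀) ∧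
    (∀ i, i < i₀ → IsSplitEpi (f.f i)) ∧ (∀ i, i₀ < i → IsSplitMono (f.f i))

end General

/-! ## The explicit triangles

Objects of the rows are written as biproducts; in the shapes below many of the summands vanish. -/

section Triangles

variable {C : Type*} [Category C] [Preadditive C] [HasBinaryBiproducts C]

/-- Data for the triangle that starts with a smonic morphism in standard form: graded objects `X`,
`Y'` and morphisms `d : X^i ⟶ X^(i+1)`, `a : Y'^i ⟶ X^(i+1)`, `e : Y'^i ⟶ Y'^(i+1)`. -/
structure SmonicData (C : Type*) [Category C] [Preadditive C] where
  X : ℤ → C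
  Y' : ℤ → C
  d : ∀ i, X i ⟶ X (i + 1)
  a : ∀ i, Y' i ⟶ X (i + 1)
  e : ∀ i, Y' i ⟶ Y' (i + 1)
  d_d : ∀ i, d i ≫ d (i + 1) = 0
  e_e : ∀ i, e i ≫ e (i + 1) = 0
  a_d : ∀ i, a i ≫ d (i + 1) + e i ≫ a (i + 1) = 0

namespace SmonicData

variable (D : SmonicData C)

/-- The complex `(X, d)`. -/
def cplxX : CochainComplex C ℤ := CochainComplex.of D.X D.d D.d_d

/-- The complex with cells `X^i ⊞ Y'^i` and differential `(x, y) ↦ (d x + a y, e y)`. -/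
def cplxY : CochainComplex C ℤ :=
  CochainComplex.of (fun i => D.X i ⊞ D.Y' i)
    (fun i => biprod.desc (D.d i ≫ biprod.inl) (biprod.lift (D.a i) (D.e i)))
    (fun i => by
      apply biprod.hom_ext' <;> apply biprod.hom_ext <;>
        simp [D.d_d, D.e_e, D.a_d])

/-- The complex `(Y', e)`. -/
def cplxW : CochainComplex C ℤ := CochainComplex.of D.Y' D.e D.e_e

/-- The chain map `x ↦ (x, 0)`. -/
def u : D.cplxX ⟶ D.cplxY :=
  CochainComplex.ofHom (fun _ => biprod.inl) (fun i => by simp [cplxX, cplxY])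

/-- The chain map `(x, y) ↦ y`. -/
def v : D.cplxY ⟶ D.cplxW :=
  CochainComplex.ofHom (fun _ => biprod.snd) (fun i => by
    apply biprod.hom_ext' <;> simp [cplxY, cplxW])

/-- The chain map `y ↦ -a y`. -/
def w : D.cplxW ⟶ D.cplxX⟦(1 : ℤ)⟧ :=
  CochainComplex.ofHom (fun i => (-D.a i : D.Y' i ⟶ D.X (i + 1))) (fun i => by
    have := D.a_d i
    simpa [cplxW, cplxX] using eq_neg_of_add_eq_zero_left this)

/-- The triangle with rows `(X, d)`, `(X ⊞ Y', (d, a; 0, e))`, `(Y', e)` and `(X, d)⟦1⟧`, and with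
the morphisms `(1; 0)`, `(0, 1)` and `-a`. -/
def triangle : Triangle (CochainComplex C ℤ) := Triangle.mk D.u D.v D.w

end SmonicData

/-- Data for the triangles that start with a sepic or sirreducible morphism in standard form: graded
objects `A`, `E`, `B` and morphisms `α : A^i ⟶ A^(i+1)`, `e : E^i ⟶ E^(i+1)`, `β : B^i ⟶ B^(i+1)`,
`b : A^i ⟶ E^(i+1)`, `f : E^i ⟶ B^i`. -/
structure ConeData (C : Type*) [Category C] [Preadditive C] where
  A : ℤ → C
  E : ℤ → C
  B : ℤ → C
  α : ∀ i, A i ⟶ A (i + 1)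
  e : ∀ i, E i ⟶ E (i + 1)
  β : ∀ i, B i ⟶ B (i + 1)
  b : ∀ i, A i ⟶ E (i + 1)
  f : ∀ i, E i ⟶ B i
  α_α : ∀ i, α i ≫ α (i + 1) = 0
  e_e : ∀ i, e i ≫ e (i + 1) = 0
  β_β : ∀ i, β i ≫ β (i + 1) = 0
  α_b : ∀ i, α i ≫ b (i + 1) + b i ≫ e (i + 1) = 0
  f_β : ∀ i, f i ≫ β i = e i ≫ f (i + 1)

namespace ConeData

variable (D : ConeData C)

/-- The complex with cells `A^i ⊞ E^i` and differential `(x, y) ↦ (α x, b x + e y)`. -/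
def cplxX : CochainComplex C ℤ :=
  CochainComplex.of (fun i => D.A i ⊞ D.E i)
    (fun i => biprod.desc (biprod.lift (D.α i) (D.b i)) (D.e i ≫ biprod.inr))
    (fun i => by
      apply biprod.hom_ext' <;> apply biprod.hom_ext <;>
        simp [D.α_α, D.e_e, D.α_b])

/-- The complex with cells `A^i ⊞ B^i` and differential `(x, z) ↦ (α x, f (b x) + β z)`. -/
def cplxY : CochainComplex C ℤ :=
  CochainComplex.of (fun i => D.A i ⊞ D.B i)
    (fun i => biprod.desc (biprod.lift (D.α i) (D.b i ≫ D.f (i + 1))) (D.β i ≫ biprod.inr))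
    (fun i => by
      have : D.α i ≫ D.b (i + 1) ≫ D.f (i + 1 + 1) +
          D.b i ≫ D.e (i + 1) ≫ D.f (i + 1 + 1) = 0 := by
        simpa using congrArg (fun t => t ≫ D.f (i + 1 + 1)) (D.α_b i)
      apply biprod.hom_ext' <;> apply biprod.hom_ext <;>
        simp [D.α_α, D.β_β, D.f_β, this])

/-- The complex with cells `E^(i+1) ⊞ B^i` and differential `(y, z) ↦ (-e y, f y + β z)`. -/
def cplxW : CochainComplex C ℤ :=
  CochainComplex.of (fun i => D.E (i + 1) ⊞ D.B i)
    (fun i => biprod.desc (biprod.lift (-D.e (i + 1)) (D.f (i + 1))) (D.β i ≫ biprod.inr))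
    (fun i => by
      apply biprod.hom_ext' <;> apply biprod.hom_ext <;>
        simp [D.e_e, D.β_β, D.f_β])

/-- The chain map `(x, y) ↦ (x, f y)`. -/
def u : D.cplxX ⟶ D.cplxY :=
  CochainComplex.ofHom (fun i => biprod.map (𝟙 (D.A i)) (D.f i)) (fun i => by
      apply biprod.hom_ext' <;> apply biprod.hom_ext <;>
        simp [cplxX, cplxY, D.f_β])

/-- The chain map `(x, z) ↦ (b x, z)`. -/
def v : D.cplxY ⟶ D.cplxW :=
  CochainComplex.ofHom (fun i => biprod.map (D.b i) (𝟙 (D.B i))) (fun i => by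
      have : D.α i ≫ D.b (i + 1) = -D.b i ≫ D.e (i + 1) := by
        simpa using eq_neg_of_add_eq_zero_left (D.α_b i)
      apply biprod.hom_ext' <;> apply biprod.hom_ext <;>
        simp [cplxY, cplxW, this])

/-- The chain map `(y, z) ↦ (0, y)`. -/
def w : D.cplxW ⟶ D.cplxX⟦(1 : ℤ)⟧ :=
  CochainComplex.ofHom
    (fun i => (biprod.fst ≫ biprod.inr : D.E (i + 1) ⊞ D.B i ⟶ D.A (i + 1) ⊞ D.E (i + 1)))
    (fun i => by
      apply biprod.hom_ext' <;> apply biprod.hom_ext <;>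
        simp [cplxX, cplxW])

/-- The triangle with the three complexes and chain maps above. -/
def triangle : Triangle (CochainComplex C ℤ) := Triangle.mk D.u D.v D.w

end ConeData

end Triangles

/-! ## The category of finitely generated projective modules -/

variable (R : Type u) [Ring R]

/-- The finitely generated projective `R`-modules. -/
def fgProj : ObjectProperty (ModuleCat.{u} R) :=
  fun M => Module.Finite R M ∧ Module.Projective R M

/-- The full subcategory of finitely generated projective `R`-modules. -/
abbrev Proj : Type (u + 1) := (fgProj R).FullSubcategory

instance : (fgProj R).IsClosedUnderIsomorphisms where
  of_iso e h :=
    ⟨(Module.Finite.equiv_iff e.toLinearEquiv).1 h.1,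
      have := h.2; Module.Projective.of_equiv e.toLinearEquiv⟩

instance : (fgProj R).ContainsZero where
  exists_zero := by
    refine ⟨ModuleCat.of R PUnit.{u + 1}, ModuleCat.isZero_of_subsingleton _, ?_, ?_⟩
    · change Module.Finite R PUnit.{u + 1}
      infer_instance
    · change Module.Projective R PUnit.{u + 1}
      infer_instance

instance : HasBinaryBiproducts (Proj R) where
  has_binary_biproduct M N := by
    have := M.property.1
    have := M.property.2
    have := N.property.1
    have := N.property.2
    have hP : fgProj R (ModuleCat.of R (M.obj × N.obj)) := by
      constructor
      · change Module.Finite R (M.obj × N.obj)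
        infer_instance
      · change Module.Projective R (M.obj × N.obj)
        infer_instance
    exact HasBinaryBiproduct.mk
      { bicone :=
          { pt := ⟨_, hP⟩
            fst := ObjectProperty.homMk (ModuleCat.ofHom (LinearMap.fst R M.obj N.obj))
            snd := ObjectProperty.homMk (ModuleCat.ofHom (LinearMap.snd R M.obj N.obj))
            inl := ObjectProperty.homMk (ModuleCat.ofHom (LinearMap.inl R M.obj N.obj))
            inr := ObjectProperty.homMk (ModuleCat.ofHom (LinearMap.inr R M.obj N.obj))
            inl_fst := by ext; simp
            inl_snd := by ext; simp
            inr_fst := by ext; simp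
            inr_snd := by ext; simp }
        isBilimit := isBinaryBilimitOfTotal _ (by
          apply ObjectProperty.hom_ext
          apply ModuleCat.hom_ext
          refine LinearMap.ext fun x => ?_
          change ((x.1, 0) : M.obj × N.obj) + (0, x.2) = x
          simp) }

/-! ## Minimal projective complexes and their homotopy category -/

variable {R}

/-- Complexes of finitely generated projective modules. -/
abbrev Cplx (R : Type u) [Ring R] := CochainComplex (Proj R) ℤ

/-- The homotopy category of complexes of finitely generated projective modules. -/
abbrev K (R : Type u) [Ring R] := HomotopyCategory (Proj R) (ComplexShape.up ℤ)

/-- The functor sending a chain map to its homotopy class. -/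
abbrev Q (R : Type u) [Ring R] : Cplx R ⥤ K R := HomotopyCategory.quotient _ _

/-- `X` is a minimal projective complex with cells zero outside `J`: the image of every differential
lies in the radical of its target. -/
structure IsMinimalOn (J : Set ℤ) (X : Cplx R) : Prop where
  range_le : ∀ i : ℤ,
    LinearMap.range (X.d i (i + 1)).hom.hom ≤ Module.jacobson R (X.X (i + 1)).obj
  isZero : ∀ i : ℤ, i ∉ J → IsZero (X.X i)

/-- `X` is indecomposable in the full subcategory of the homotopy category whose objects are the
minimal projective complexes with cells zero outside `J`. -/
def IsIndecomposableOn (J : Set ℤ) (X : Cplx R) : Prop :=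
  ¬ IsZero ((Q R).obj X) ∧ ∀ A B : Cplx R, IsMinimalOn J A → IsMinimalOn J B →
    Nonempty ((Q R).obj X ≅ (Q R).obj (A ⊞ B)) → IsZero ((Q R).obj A) ∨ IsZero ((Q R).obj B)

/-- The projection of the mapping cone, `C_f ⟶ X⟦1⟧`. (The third morphism of
`CochainComplex.mappingCone.triangle f` is minus this projection.) -/
def coneProj {X Y : Cplx R} (f : X ⟶ Y) : CochainComplex.mappingCone f ⟶ X⟦(1 : ℤ)⟧ :=
  CochainComplex.HomComplex.Cocycle.homOf
    ((CochainComplex.mappingCone.fst f).rightShift 1 0 (zero_add 1))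

/-- The standard triangle `X ⟶ Y ⟶ C_f ⟶ X⟦1⟧`, with the inclusion and the projection of the
mapping cone. -/
def standardTriangle {X Y : Cplx R} (f : X ⟶ Y) : Triangle (Cplx R) :=
  Triangle.mk f (CochainComplex.mappingCone.inr f) (coneProj f)

/-- Two triangles of complexes are isomorphic as triangles of the homotopy category. -/
def IsoInK (T T' : Triangle (Cplx R)) : Prop :=
  Nonempty ((Q R).mapTriangle.obj T ≅ (Q R).mapTriangle.obj T')

/-- The triangle is distinguished in the homotopy category: it is isomorphic there to the standard
triangle of a chain map. -/
def IsDistinguished (T : Triangle (Cplx R)) : Prop :=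
  ∃ (X Y : Cplx R) (f : X ⟶ Y), IsoInK T (standardTriangle f)

/-- Auslander-Reiten triangles in the homotopy category of minimal projective complexes with cells
zero outside `J`. The morphisms are given by chain maps representing them. -/
structure IsARTriangle (J : Set ℤ) (T : Triangle (Cplx R)) : Prop where
  mem₁ : IsMinimalOn J T.obj₁
  mem₂ : IsMinimalOn J T.obj₂
  mem₃ : IsMinimalOn J T.obj₃
  distinguished : IsDistinguished T
  indecomposable₁ : IsIndecomposableOn J T.obj₁
  indecomposable₃ : IsIndecomposableOn J T.obj₃
  mor₃_ne_zero : (Q R).map T.mor₃ ≠ 0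
  exists_lift : ∀ W : Cplx R, IsMinimalOn J W → ∀ f : (Q R).obj W ⟶ (Q R).obj T.obj₃,
    ¬ IsSplitEpi f → ∃ f' : (Q R).obj W ⟶ (Q R).obj T.obj₂, f' ≫ (Q R).map T.mor₂ = f

/-- The three objects of `T'` are minimal projective complexes with cells zero outside `J`, and `T`
is isomorphic to `T'` in the homotopy category. -/
def IsoOn (J : Set ℤ) (T T' : Triangle (Cplx R)) : Prop :=
  IsMinimalOn J T'.obj₁ ∧ IsMinimalOn J T'.obj₂ ∧ IsMinimalOn J T'.obj₃ ∧ IsoInK T T'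

/-- `T` is isomorphic to the triangle
```
X     : ⋯ → X^i          → X^(i+1)              → ⋯
Y     : ⋯ → X^i ⊞ Y'^i   → X^(i+1) ⊞ Y'^(i+1)   → ⋯
W     : ⋯ → Y'^i         → Y'^(i+1)             → ⋯
X[1]  : ⋯ → X^(i+1)      → X^(i+2)              → ⋯
``` -/
def HasShapeSmonic (J : Set ℤ) (T : Triangle (Cplx R)) : Prop :=
  ∃ D : SmonicData (Proj R), IsoOn J T D.triangle

/-- `T` is isomorphic to the triangle (columns `i-1`, `i`, `i+1`, `i+2`)
```
X     : ⋯ → A^(i-1) -α→ A^i     -b→ E^(i+1) -e→  E^(i+2) → ⋯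
Y     : ⋯ → A^(i-1) -α→ A^i      →  0        →   0       → ⋯
W     : ⋯ → 0        →  E^(i+1) -(-e)→ E^(i+2) → E^(i+3) → ⋯
X[1]  : ⋯ → A^i -(-b)→  E^(i+1) -(-e)→ E^(i+2) → E^(i+3) → ⋯
```
with `b : A^i ⟶ E^(i+1)` irreducible. -/
def HasShapeSepic (J : Set ℤ) (T : Triangle (Cplx R)) : Prop :=
  ∃ (D : ConeData (Proj R)) (i : ℤ),
    (∀ n, i < n → IsZero (D.A n)) ∧ (∀ n, n ≤ i → IsZero (D.E n)) ∧ (∀ n, IsZero (D.B n)) ∧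
    IsIrreducibleMor (D.b i) ∧ IsoOn J T D.triangle

/-- `T` is isomorphic to the triangle (columns `i-1`, `i`, `i+1`)
```
X     : ⋯ → E^(i-1)  -e→ E^i  → 0        → ⋯
Y     : ⋯ → 0         →  B^i -β→ B^(i+1) → ⋯
W     : ⋯ → E^i      -f→ B^i -β→ B^(i+1) → ⋯
X[1]  : ⋯ → E^i       →  0    → 0        → ⋯
```
with `f : E^i ⟶ B^i` irreducible. -/
def HasShapeSirreducible₁ (J : Set ℤ) (T : Triangle (Cplx R)) : Prop :=
  ∃ (D : ConeData (Proj R)) (i : ℤ),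
    (∀ n, IsZero (D.A n)) ∧ (∀ n, i < n → IsZero (D.E n)) ∧ (∀ n, n < i → IsZero (D.B n)) ∧
    IsIrreducibleMor (D.f i) ∧ IsoOn J T D.triangle

/-- For some `j ≤ i - 2`, `T` is isomorphic to the triangle (columns `j`, `j+1`, …, `i-1`, `i`,
`i+1`)
```
X     : ⋯ → A^j     -b→    E^(j+1) -e→ ⋯ → E^(i-1) -e→ E^i  → 0        → ⋯
Y     : ⋯ → A^j      →     0        →  ⋯ → 0        →  B^i -β→ B^(i+1) → ⋯
W     : ⋯ → E^(j+1) -(-e)→ E^(j+2)  →  ⋯ → E^i     -f→ B^i -β→ B^(i+1) → ⋯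
X[1]  : ⋯ → E^(j+1) -(-e)→ E^(j+2)  →  ⋯ → E^i      →  0    →  0       → ⋯
```
with `b : A^j ⟶ E^(j+1)` and `f : E^i ⟶ B^i` irreducible. -/
def HasShapeSirreducible₂ (J : Set ℤ) (T : Triangle (Cplx R)) : Prop :=
  ∃ (D : ConeData (Proj R)) (i j : ℤ), j ≤ i - 2 ∧
    (∀ n, j < n → IsZero (D.A n)) ∧ (∀ n, n ≤ j → IsZero (D.E n)) ∧
    (∀ n, i < n → IsZero (D.E n)) ∧ (∀ n, n < i → IsZero (D.B n)) ∧
    IsIrreducibleMor (D.f i) ∧ IsIrreducibleMor (D.b j) ∧ IsoOn J T D.triangle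

/-- `T` is isomorphic to the triangle (columns `i-2`, `i-1`, `i`, `i+1`)
```
X     : ⋯ → A^(i-2) -α→ A^(i-1) -b→      E^i  → 0        → ⋯
Y     : ⋯ → A^(i-2) -α→ A^(i-1) -(f∘b)→  B^i -β→ B^(i+1) → ⋯
W     : ⋯ → 0        →  E^i     -f→      B^i -β→ B^(i+1) → ⋯
X[1]  : ⋯ → A^(i-1) -(-b)→ E^i   →       0    →  0       → ⋯
```
with `b : A^(i-1) ⟶ E^i` and `f : E^i ⟶ B^i` irreducible. -/
def HasShapeSirreducible₃ (J : Set ℤ) (T : Triangle (Cplx R)) : Prop :=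
  ∃ (D : ConeData (Proj R)) (i : ℤ),
    (∀ n, i - 1 < n → IsZero (D.A n)) ∧ (∀ n, n ≠ i → IsZero (D.E n)) ∧
    (∀ n, n < i → IsZero (D.B n)) ∧
    IsIrreducibleMor (D.f i) ∧ IsIrreducibleMor (D.b (i - 1)) ∧ IsoOn J T D.triangle

/-- Some nonzero direct factor `R e` of the ring `R` (with `e` a central idempotent) is
semisimple. -/
def HasSemisimpleFactor (R : Type u) [Ring R] : Prop :=
  ∃ e : R, e ≠ 0 ∧ IsIdempotentElem e ∧ e ∈ Subring.center R ∧
    IsSemisimpleModule R (Ideal.span {e})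

end ARTriangles

end

noncomputable section

namespace ARTriangles

variable {R : Type u} [Ring R]

/-! Between minimal complexes, a homotopy changes each component of a chain map only by a radical
map (`isRad_sub_of_map_eq`), and over an Artinian ring adding a radical map preserves split
monomorphisms and split epimorphisms. So smonic and sepic depend only on homotopy classes, and
homotopy equivalent minimal complexes are isomorphic. As a distinguished triangle is determined by
its first morphism, putting `u` into a degreewise standard form gives the whole triangle; for smonic
`u` it is a degreewise split sequence, which is (a).

An indecomposable `X` has a local endomorphism ring (degreewise Fitting decomposition), so `v` is
right minimal, and hence irreducible among minimal complexes on `J`. Test complexes turn this into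
statements about components. Interpolating between `Y` and `Z` (`exists_interpolation`) shows that a
nonsplit component of `v` is irreducible, and that in degrees above a component which is not a split
epimorphism all components are split monomorphisms. Truncating `Z` shows that in degrees above a
nonzero cell of `Z` all components of `v` are split epimorphisms. If `u` is not smonic, no nonzero
complex over `X` becomes smonic over `Y` (`isZero_of_isSmonic_comp`); so for sirreducible `u` the
complex `X` vanishes above the distinguished degree, where `u` is radical.

A sepic or sirreducible `u` then has the form `1 ⊞ f` with `f` radical, and its triangle is
`T(A,E,B)`. There `v` is `b ⊞ 1` with `b` radical: in degree `n` it is a split monomorphism iff `A^n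
= 0` and a split epimorphism iff `E^(n+1) = 0`. The truncation statement forces `E` into a single
degree, and `of_mapDecomp` reads off the shapes; in (c) only (1) and (3) arise. The remaining
possibility in (b) has `Y = 0` and `Z` a projective in one degree; that projective is simple, and
its isotypic component in the ring is a semisimple factor. -/

namespace Proj

/-! ### Morphisms of projective modules as linear maps. -/

instance (M : Proj R) : Module.Finite R M.obj := M.property.1

instance (M : Proj R) : Module.Projective R M.obj := M.property.2

/-- A finitely generated projective module as an object of `Proj R`. -/
def of (M : Type u) [AddCommGroup M] [Module R M] [Module.Finite R M] [Module.Projective R M] :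
    Proj R :=
  ⟨ModuleCat.of R M, ‹Module.Finite R M›, ‹Module.Projective R M›⟩

/-- The linear map underlying a morphism. -/
abbrev lin {M N : Proj R} (f : M ⟶ N) : M.obj →ₗ[R] N.obj := f.hom.hom

/-- The morphism given by a linear map. -/
def ofLin {M N : Proj R} (f : M.obj →ₗ[R] N.obj) : M ⟶ N :=
  ObjectProperty.homMk (ModuleCat.ofHom f)

@[simp] lemma lin_id (M : Proj R) : lin (𝟙 M) = LinearMap.id := rfl

@[simp] lemma lin_zero (M N : Proj R) : lin (0 : M ⟶ N) = 0 := rfl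

@[simp] lemma lin_add {M N : Proj R} (f g : M ⟶ N) : lin (f + g) = lin f + lin g := rfl

lemma lin_injective {M N : Proj R} {f g : M ⟶ N} (h : lin f = lin g) : f = g :=
  ObjectProperty.hom_ext _ (ModuleCat.hom_ext h)

lemma isIso_of_bijective {M N : Proj R} (f : M ⟶ N) (h : Function.Bijective (lin f)) :
    IsIso f := by
  let e := LinearEquiv.ofBijective (lin f) h
  refine ⟨ofLin e.symm.toLinearMap, lin_injective ?_, lin_injective ?_⟩
  · ext x; exact e.symm_apply_apply x
  · ext x; exact e.apply_symm_apply x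

lemma isZero_iff_subsingleton (M : Proj R) : IsZero M ↔ Subsingleton M.obj := by
  rw [IsZero.iff_id_eq_zero]
  constructor
  · intro h
    refine ⟨fun x y => ?_⟩
    have h' := fun z => LinearMap.congr_fun (congrArg lin h) z
    simp only [lin_id, LinearMap.id_coe, id_eq, lin_zero, LinearMap.zero_apply] at h'
    rw [h' x, h' y]
  · intro h
    apply lin_injective
    ext x
    exact Subsingleton.elim _ _

end Proj

open Proj

/-! ## Radical morphisms -/

/-- The image of the morphism lies in the radical of its target. -/
def IsRad {M N : Proj R} (f : M ⟶ N) : Prop :=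
  LinearMap.range (lin f) ≤ Module.jacobson R N.obj

namespace IsRad

variable {M N P : Proj R}

lemma zero : IsRad (0 : M ⟶ N) := by
  rintro _ ⟨x, rfl⟩
  exact Submodule.zero_mem _

lemma add {f g : M ⟶ N} (hf : IsRad f) (hg : IsRad g) : IsRad (f + g) := by
  rintro _ ⟨x, rfl⟩
  exact Submodule.add_mem _ (hf ⟨x, rfl⟩) (hg ⟨x, rfl⟩)

lemma neg {f : M ⟶ N} (hf : IsRad f) : IsRad (-f) := by
  rintro _ ⟨x, rfl⟩
  exact Submodule.neg_mem _ (hf ⟨x, rfl⟩)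

lemma comp_left (f : M ⟶ N) {g : N ⟶ P} (hg : IsRad g) : IsRad (f ≫ g) := by
  rintro _ ⟨x, rfl⟩
  exact hg ⟨lin f x, rfl⟩

lemma comp_right {f : M ⟶ N} (hf : IsRad f) (g : N ⟶ P) : IsRad (f ≫ g) := by
  rintro _ ⟨x, rfl⟩
  exact Module.map_jacobson_le (lin g) ⟨_, hf ⟨x, rfl⟩, rfl⟩

/-- Nakayama: a maximal submodule containing the range also contains the range of `r`, hence
everything. A surjective endomorphism of a Noetherian module is injective. -/
lemma isIso_id_add [IsArtinianRing R] {r : M ⟶ M} (hr : IsRad r) : IsIso (𝟙 M + r) := by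
  apply isIso_of_bijective
  have hs : Function.Surjective (lin (𝟙 M + r)) := by
    rw [← LinearMap.range_eq_top]
    by_contra hne
    obtain ⟨L, hL, hle⟩ := (eq_top_or_exists_le_coatom _).resolve_left hne
    refine hL.1 (eq_top_iff.2 fun x _ => ?_)
    have h1 : lin (𝟙 M + r) x ∈ L := hle ⟨x, rfl⟩
    have h2 : lin r x ∈ L := (sInf_le (show L ∈ {m | IsCoatom m} from hL) :
      Module.jacobson R M.obj ≤ L) (hr ⟨x, rfl⟩)
    have : x = lin (𝟙 M + r) x - lin r x := by simp
    rw [this]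
    exact L.sub_mem h1 h2
  exact ⟨IsNoetherian.injective_of_surjective_endomorphism _ hs, hs⟩

end IsRad

/-! ### Split monomorphisms and split epimorphisms. -/

section Split

variable {C : Type*} [Category C] {M N P : C}

lemma isSplitMono_of_isIso_comp (f : M ⟶ N) (g : N ⟶ P) (h : IsIso (f ≫ g)) : IsSplitMono f :=
  ⟨⟨⟨g ≫ inv (f ≫ g), by rw [← Category.assoc, IsIso.hom_inv_id]⟩⟩⟩

lemma isSplitEpi_of_isIso_comp (f : M ⟶ N) (g : N ⟶ P) (h : IsIso (f ≫ g)) : IsSplitEpi g :=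
  ⟨⟨⟨inv (f ≫ g) ≫ f, by rw [Category.assoc, IsIso.inv_hom_id]⟩⟩⟩

lemma isSplitMono_of_comp (f : M ⟶ N) (g : N ⟶ P) (h : IsSplitMono (f ≫ g)) : IsSplitMono f :=
  ⟨⟨⟨g ≫ retraction (f ≫ g), by rw [← Category.assoc, IsSplitMono.id]⟩⟩⟩

lemma isSplitEpi_of_comp (f : M ⟶ N) (g : N ⟶ P) (h : IsSplitEpi (f ≫ g)) : IsSplitEpi g :=
  ⟨⟨⟨section_ (f ≫ g) ≫ f, by rw [Category.assoc, IsSplitEpi.id]⟩⟩⟩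

lemma isSplitMono_comp (f : M ⟶ N) (g : N ⟶ P) (hf : IsSplitMono f) (hg : IsSplitMono g) :
    IsSplitMono (f ≫ g) :=
  ⟨⟨⟨retraction g ≫ retraction f, by simp⟩⟩⟩

lemma isSplitEpi_comp (f : M ⟶ N) (g : N ⟶ P) (hf : IsSplitEpi f) (hg : IsSplitEpi g) :
    IsSplitEpi (f ≫ g) :=
  ⟨⟨⟨section_ g ≫ section_ f, by simp⟩⟩⟩

lemma isSplitMono_of_isZero [HasZeroMorphisms C] (f : M ⟶ N) (h : IsZero M) : IsSplitMono f :=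
  ⟨⟨⟨0, h.eq_of_src _ _⟩⟩⟩

lemma isSplitEpi_of_isZero [HasZeroMorphisms C] (f : M ⟶ N) (h : IsZero N) : IsSplitEpi f :=
  ⟨⟨⟨0, h.eq_of_src _ _⟩⟩⟩

end Split

section Artinian

variable [IsArtinianRing R] {M N : Proj R}

lemma IsRad.isSplitMono_add {f r : M ⟶ N} (hr : IsRad r) (hf : IsSplitMono f) :
    IsSplitMono (f + r) := by
  apply isSplitMono_of_isIso_comp _ (retraction f)
  rw [Preadditive.add_comp, IsSplitMono.id]
  exact (hr.comp_right _).isIso_id_add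

lemma IsRad.isSplitEpi_add {f r : M ⟶ N} (hr : IsRad r) (hf : IsSplitEpi f) :
    IsSplitEpi (f + r) := by
  apply isSplitEpi_of_isIso_comp (section_ f) _
  rw [Preadditive.comp_add, IsSplitEpi.id]
  exact (hr.comp_left _).isIso_id_add

lemma IsRad.isZero_of_id (h : IsRad (𝟙 M)) : IsZero M := by
  have := h.neg.isIso_id_add
  rw [add_neg_cancel] at this
  rw [IsZero.iff_id_eq_zero, ← cancel_mono (0 : M ⟶ M)]
  simp

lemma IsRad.isZero_of_isSplitMono {f : M ⟶ N} (hr : IsRad f) (hf : IsSplitMono f) : IsZero M := by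
  apply IsRad.isZero_of_id
  rw [← IsSplitMono.id f]
  exact hr.comp_right _

lemma IsRad.isZero_of_isSplitEpi {f : M ⟶ N} (hr : IsRad f) (hf : IsSplitEpi f) : IsZero N := by
  apply IsRad.isZero_of_id
  rw [← IsSplitEpi.id f]
  exact hr.comp_left _

end Artinian

/-! ## Complements and Fitting decompositions -/

/-- A direct summand given by a submodule with a linear projection onto it. -/
lemma exists_retract_of_isCompl {M : Proj R} {p q : Submodule R M.obj} (h : IsCompl p q) :
    ∃ (A B : Proj R) (i : A ⟶ M) (r : M ⟶ A) (j : B ⟶ M) (s : M ⟶ B),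
      i ≫ r = 𝟙 A ∧ j ≫ s = 𝟙 B ∧ i ≫ s = 0 ∧ j ≫ r = 0 ∧ r ≫ i + s ≫ j = 𝟙 M ∧
      LinearMap.range (lin i) = p ∧ LinearMap.range (lin j) = q := by
  have fp : Function.LeftInverse (p.projectionOnto q h) p.subtype := fun x => by simp
  have fq : Function.LeftInverse (q.projectionOnto p h.symm) q.subtype := fun x => by simp
  have : Module.Finite R p := Module.Finite.of_surjective _ fp.surjective
  have : Module.Finite R q := Module.Finite.of_surjective _ fq.surjective
  have : Module.Projective R p := Module.Projective.of_split p.subtype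
    (p.projectionOnto q h) (LinearMap.ext fp)
  have : Module.Projective R q := Module.Projective.of_split q.subtype
    (q.projectionOnto p h.symm) (LinearMap.ext fq)
  refine ⟨of p, of q, ofLin p.subtype, ofLin (p.projectionOnto q h),
    ofLin q.subtype, ofLin (q.projectionOnto p h.symm), lin_injective (LinearMap.ext fp),
    lin_injective (LinearMap.ext fq), lin_injective (LinearMap.ext fun x => ?_),
    lin_injective (LinearMap.ext fun x => ?_), lin_injective (LinearMap.ext fun x => ?_), ?_, ?_⟩
  · exact Submodule.projectionOnto_apply_right h.symm x
  · exact Submodule.projectionOnto_apply_right h x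
  · exact Submodule.projection_add_projection_eq_self h x
  · exact Submodule.range_subtype p
  · exact Submodule.range_subtype q

lemma exists_complement {M N : Proj R} (i : M ⟶ N) (r : N ⟶ M) (hir : i ≫ r = 𝟙 M) :
    ∃ (B : Proj R) (j : B ⟶ N) (s : N ⟶ B),
      j ≫ s = 𝟙 B ∧ i ≫ s = 0 ∧ j ≫ r = 0 ∧ r ≫ i + s ≫ j = 𝟙 N := by
  have hir' : ∀ x, lin r (lin i x) = x := LinearMap.congr_fun (congrArg lin hir)
  let p : N.obj →ₗ[R] LinearMap.ker (lin r) :=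
    (LinearMap.id - lin i ∘ₗ lin r).codRestrict _ fun x => by simp [hir']
  have hp : Function.LeftInverse p (LinearMap.ker (lin r)).subtype := fun x => by
    apply Subtype.ext
    have : lin r x = 0 := x.2
    simp [p, this]
  have : Module.Finite R (LinearMap.ker (lin r)) := Module.Finite.of_surjective p hp.surjective
  have : Module.Projective R (LinearMap.ker (lin r)) :=
    Module.Projective.of_split _ p (LinearMap.ext hp)
  refine ⟨of (LinearMap.ker (lin r)), ofLin (LinearMap.ker (lin r)).subtype, ofLin p,
    lin_injective (LinearMap.ext hp), lin_injective (LinearMap.ext fun x => ?_),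
    lin_injective (LinearMap.ext fun x => x.2), lin_injective (LinearMap.ext fun x => ?_)⟩
  · apply Subtype.ext
    change lin i x - lin i (lin r (lin i x)) = 0
    rw [hir', sub_self]
  · change lin i (lin r x) + (x - lin i (lin r x)) = x
    abel

/-- The Fitting decomposition of an endomorphism. -/
lemma exists_fitting [IsArtinianRing R] {M : Proj R} (e : M ⟶ M) :
    ∃ (A B : Proj R) (i : A ⟶ M) (r : M ⟶ A) (j : B ⟶ M) (s : M ⟶ B),
      (i ≫ r = 𝟙 A ∧ j ≫ s = 𝟙 B ∧ i ≫ s = 0 ∧ j ≫ r = 0 ∧ r ≫ i + s ≫ j = 𝟙 M) ∧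
      LinearMap.range (lin i) = ⨆ n : ℕ, LinearMap.ker (lin e ^ n : Module.End R M.obj) ∧
      LinearMap.range (lin j) = ⨅ n : ℕ, LinearMap.range (lin e ^ n : Module.End R M.obj) ∧
      (∃ n : ℕ, ∀ x, (lin e ^ n : Module.End R M.obj) (lin i x) = 0) ∧ IsIso (j ≫ e ≫ s) := by
  have hc := LinearMap.isCompl_iSup_ker_pow_iInf_range_pow (lin e : Module.End R M.obj)
  obtain ⟨A, B, i, r, j, s, h1, h2, h3, h4, h5, h6, h7⟩ := exists_retract_of_isCompl hc
  refine ⟨A, B, i, r, j, s, ⟨h1, h2, h3, h4, h5⟩, h6, h7, ?_, ?_⟩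
  · obtain ⟨n, hn⟩ := (LinearMap.eventually_iSup_ker_pow_eq (lin e : Module.End R M.obj)).exists
    refine ⟨n, fun x => ?_⟩
    have : lin i x ∈ LinearMap.range (lin i) := ⟨x, rfl⟩
    rw [h6, hn] at this
    exact this
  · apply isIso_of_bijective
    apply IsArtinian.bijective_of_injective_endomorphism
    rw [← LinearMap.ker_eq_bot, LinearMap.ker_eq_bot']
    intro x hx
    have hjx : lin j x ∈ LinearMap.range (lin j) := ⟨x, rfl⟩
    have hs : ∀ y, lin s (lin j y) = y := LinearMap.congr_fun (congrArg lin h2)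
    -- The stable range is preserved by `e`, so projecting back with `s` loses nothing.
    have hejx : lin e (lin j x) ∈ LinearMap.range (lin j) := by
      rw [h7, Submodule.mem_iInf] at hjx ⊢
      intro n
      obtain ⟨y, hy⟩ := hjx n
      refine ⟨lin e y, ?_⟩
      rw [← hy, ← Module.End.mul_apply, ← Module.End.mul_apply, ← pow_succ, pow_succ']
    have h0 : lin e (lin j x) = 0 := by
      obtain ⟨y, hy⟩ := hejx
      have hx' : lin s (lin e (lin j x)) = 0 := hx
      rw [← hy, hs] at hx'
      rw [← hy, hx', map_zero]
    have hker : lin j x ∈ ⨆ n : ℕ, LinearMap.ker (lin e ^ n : Module.End R M.obj) :=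
      Submodule.mem_iSup_of_mem 1 (by simpa using h0)
    have := hc.disjoint.le_bot ⟨hker, h7 ▸ hjx⟩
    rw [← hs x, (Submodule.mem_bot R).1 this, map_zero]

/-- If no nonzero direct summand of the source is mapped split monomorphically, the morphism is
radical. -/
lemma isRad_of_forall_isZero [IsArtinianRing R] {M N : Proj R} (g : M ⟶ N)
    (h : ∀ (A : Proj R) (i : A ⟶ M), IsSplitMono (i ≫ g) → IsZero A) : IsRad g := by
  by_contra hg
  obtain ⟨L, hL, hgL⟩ : ∃ L : Submodule R N.obj, IsCoatom L ∧ ¬ LinearMap.range (lin g) ≤ L := by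
    by_contra! hcon
    exact hg (le_sInf hcon)
  have hsup : LinearMap.range (lin g) ⊔ L = ⊤ := by
    rcases hL.le_iff.1 (le_sup_right : L ≤ LinearMap.range (lin g) ⊔ L) with h | h
    · exact h
    · exact absurd (h ▸ le_sup_left) hgL
  have hsurj : Function.Surjective (L.mkQ ∘ₗ lin g) := by
    rw [← LinearMap.range_eq_top, LinearMap.range_comp, eq_top_iff]
    rintro y -
    obtain ⟨y, rfl⟩ := L.mkQ_surjective y
    obtain ⟨a, ha, b, hb, rfl⟩ := Submodule.mem_sup.1 (hsup ▸ Submodule.mem_top : y ∈ _)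
    refine ⟨a, ha, ?_⟩
    have : L.mkQ b = 0 := by simpa using hb
    rw [map_add, this, add_zero]
  obtain ⟨t, ht⟩ := Module.projective_lifting_property (L.mkQ ∘ₗ lin g) L.mkQ hsurj
  -- After the map to `N / L`, `e` acts as the identity. Where `e` is invertible `g` is a split
  -- monomorphism, so that Fitting part vanishes and `e` is nilpotent; then the map to `N / L` is
  -- zero.
  let e : M ⟶ M := g ≫ ofLin t
  have hpow : ∀ n : ℕ,
      L.mkQ ∘ₗ lin g ∘ₗ (lin e ^ n : Module.End R M.obj) = L.mkQ ∘ₗ lin g := by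
    intro n
    induction n with
    | zero => rfl
    | succ n ih =>
      rw [pow_succ']
      change ((L.mkQ ∘ₗ lin g) ∘ₗ t) ∘ₗ lin g ∘ₗ (lin e ^ n : Module.End R M.obj) = _
      rw [ht]
      exact ih
  obtain ⟨A, B, i, r, j, s, ⟨h1, h2, h3, h4, h5⟩, -, -, ⟨n, hn⟩, hiso⟩ := exists_fitting e
  have hB : IsZero B := h B j (isSplitMono_of_isIso_comp _ (ofLin t ≫ s) (by simpa [e] using hiso))
  have hi : r ≫ i = 𝟙 M := by rw [← h5, hB.eq_of_tgt s 0, zero_comp, add_zero]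
  have h0 : L.mkQ ∘ₗ lin g = 0 := by
    rw [← hpow n]
    ext x
    have hx : lin i (lin r x) = x := LinearMap.congr_fun (congrArg lin hi) x
    change L.mkQ (lin g ((lin e ^ n : Module.End R M.obj) x)) = 0
    rw [← hx, hn, map_zero, map_zero]
  apply hL.1
  rw [eq_top_iff]
  intro y _
  obtain ⟨x, hx⟩ := hsurj (L.mkQ y)
  rw [h0] at hx
  simpa using hx.symm

/-! ## Minimal complexes in the homotopy category -/

/-- All differentials are radical. -/
def IsMinimal (X : Cplx R) : Prop := ∀ i j : ℤ, IsRad (X.d i j)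

lemma IsMinimalOn.isMinimal {J : Set ℤ} {X : Cplx R} (h : IsMinimalOn J X) : IsMinimal X := by
  intro i j
  by_cases hij : i + 1 = j
  · subst hij
    exact h.range_le i
  · rw [X.shape i j hij]
    exact IsRad.zero

lemma IsMinimal.isMinimalOn {J : Set ℤ} {X : Cplx R} (h : IsMinimal X)
    (hJ : ∀ i, i ∉ J → IsZero (X.X i)) : IsMinimalOn J X :=
  ⟨fun i => h i (i + 1), hJ⟩

lemma isMinimal_of_isIso {X Y : Cplx R} (hX : IsMinimal X) (f : X ⟶ Y) [IsIso f] :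
    IsMinimal Y := by
  intro i j
  have : Y.d i j = (inv f).f i ≫ X.d i j ≫ f.f j := by
    rw [← f.comm, ← Category.assoc, ← HomologicalComplex.comp_f]
    simp
  rw [this]
  exact ((hX i j).comp_right _).comp_left _

lemma isZero_cells_of_isZero {X : Cplx R} (h : IsZero X) (n : ℤ) : IsZero (X.X n) :=
  (HomologicalComplex.eval _ _ n).map_isZero h

lemma isZero_of_cells {X : Cplx R} (h : ∀ n, IsZero (X.X n)) : IsZero X := by
  rw [IsZero.iff_id_eq_zero]
  ext1 n
  exact (h n).eq_of_src _ _

section Homotopy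

variable {X Y Z : Cplx R}

/-- The difference is `d h + h d`, and each summand passes through a radical differential. -/
lemma isRad_sub_of_map_eq (hX : IsMinimal X) (hY : IsMinimal Y) {f g : X ⟶ Y}
    (h : (Q R).map f = (Q R).map g) (n : ℤ) : IsRad (f.f n - g.f n) := by
  have H := HomotopyCategory.homotopyOfEq f g h
  rw [H.comm n, dNext_eq H.hom (show (ComplexShape.up ℤ).Rel n (n + 1) from rfl),
    prevD_eq H.hom (show (ComplexShape.up ℤ).Rel (n - 1) n by simp), add_sub_cancel_right]
  exact ((hX _ _).comp_right _).add ((hY _ _).comp_left _)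

/-- Homotopic maps agree in a degree where all homotopies vanish. -/
lemma f_eq_of_map_eq {f g : X ⟶ Y} (h : (Q R).map f = (Q R).map g) (n : ℤ)
    (h₁ : IsZero (X.X (n + 1)) ∨ IsZero (Y.X n)) (h₂ : IsZero (X.X n) ∨ IsZero (Y.X (n - 1))) :
    f.f n = g.f n := by
  have H := HomotopyCategory.homotopyOfEq f g h
  have e₁ : H.hom (n + 1) n = 0 := h₁.elim (fun h => h.eq_of_src _ _) (fun h => h.eq_of_tgt _ _)
  have e₂ : H.hom n (n - 1) = 0 := h₂.elim (fun h => h.eq_of_src _ _) (fun h => h.eq_of_tgt _ _)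
  rw [H.comm n, dNext_eq H.hom (show (ComplexShape.up ℤ).Rel n (n + 1) from rfl),
    prevD_eq H.hom (show (ComplexShape.up ℤ).Rel (n - 1) n by simp), e₁, e₂]
  simp

variable [IsArtinianRing R]

lemma isSplitMono_of_map_eq (hX : IsMinimal X) (hY : IsMinimal Y) {f g : X ⟶ Y}
    (h : (Q R).map f = (Q R).map g) {n : ℤ} (hf : IsSplitMono (f.f n)) :
    IsSplitMono (g.f n) := by
  have := (isRad_sub_of_map_eq hX hY h.symm n).isSplitMono_add hf
  rwa [add_sub_cancel] at this

lemma isSplitEpi_of_map_eq (hX : IsMinimal X) (hY : IsMinimal Y) {f g : X ⟶ Y}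
    (h : (Q R).map f = (Q R).map g) {n : ℤ} (hf : IsSplitEpi (f.f n)) :
    IsSplitEpi (g.f n) := by
  have := (isRad_sub_of_map_eq hX hY h.symm n).isSplitEpi_add hf
  rwa [add_sub_cancel] at this

/-- A retraction up to homotopy composes with `f` to a map homotopic to the identity of `X`, whose
components are therefore split monomorphisms. -/
lemma isSmonic_of_isSplitMono (hX : IsMinimal X) {f : X ⟶ Y}
    (hf : IsSplitMono ((Q R).map f)) : IsSmonic f := by
  intro n
  obtain ⟨r, hr⟩ := (Q R).map_surjective (retraction ((Q R).map f))
  have h : (Q R).map (𝟙 X) = (Q R).map (f ≫ r) := by simp [hr]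
  exact isSplitMono_of_comp _ _
    (isSplitMono_of_map_eq hX hX h (n := n) (by rw [HomologicalComplex.id_f]; infer_instance))

lemma isSepic_of_isSplitEpi (hY : IsMinimal Y) {f : X ⟶ Y}
    (hf : IsSplitEpi ((Q R).map f)) : IsSepic f := by
  intro n
  obtain ⟨r, hr⟩ := (Q R).map_surjective (section_ ((Q R).map f))
  have h : (Q R).map (𝟙 Y) = (Q R).map (r ≫ f) := by simp [hr]
  exact isSplitEpi_of_comp _ _
    (isSplitEpi_of_map_eq hY hY h (n := n) (by rw [HomologicalComplex.id_f]; infer_instance))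

lemma isIso_of_isIso_map (hX : IsMinimal X) (hY : IsMinimal Y) {f : X ⟶ Y}
    (hf : IsIso ((Q R).map f)) : IsIso f := by
  have h1 := isSmonic_of_isSplitMono hX (f := f) inferInstance
  have h2 := isSepic_of_isSplitEpi hY (f := f) inferInstance
  have : ∀ n, IsIso (f.f n) := fun n => by
    have := h1 n
    have := h2 n
    exact isIso_of_epi_of_isSplitMono _
  exact HomologicalComplex.Hom.isIso_of_components f

lemma isZero_of_isZero_map (hX : IsMinimal X) (h : IsZero ((Q R).obj X)) (n : ℤ) :
    IsZero (X.X n) := by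
  apply IsRad.isZero_of_id
  have := isRad_sub_of_map_eq hX hX (f := 𝟙 X) (g := 0) (h.eq_of_src _ _) n
  simpa using this

/-- Isomorphic arrows of the homotopy category between minimal complexes have the same split
monomorphisms and the same split epimorphisms among their components. -/
lemma exists_isos_of_square {X' Y' : Cplx R} (hX : IsMinimal X) (hY : IsMinimal Y)
    (hX' : IsMinimal X') (hY' : IsMinimal Y') (f : X ⟶ Y) (f' : X' ⟶ Y')
    (e₁ : (Q R).obj X ≅ (Q R).obj X') (e₂ : (Q R).obj Y ≅ (Q R).obj Y')
    (h : (Q R).map f ≫ e₂.hom = e₁.hom ≫ (Q R).map f') (n : ℤ) :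
    (IsSplitMono (f.f n) → IsSplitMono (f'.f n)) ∧
      (IsSplitEpi (f.f n) → IsSplitEpi (f'.f n)) := by
  obtain ⟨a, ha⟩ := (Q R).map_surjective e₁.hom
  obtain ⟨b, hb⟩ := (Q R).map_surjective e₂.hom
  have : IsIso a := isIso_of_isIso_map hX hX' (by rw [ha]; infer_instance)
  have : IsIso b := isIso_of_isIso_map hY hY' (by rw [hb]; infer_instance)
  have key : (Q R).map (inv a ≫ f ≫ b) = (Q R).map f' := by
    rw [Functor.map_comp, Functor.map_comp, hb, h, ← ha, ← Functor.map_comp, ← Functor.map_comp,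
      IsIso.inv_hom_id_assoc]
  constructor
  · intro hf
    refine isSplitMono_of_map_eq hX' hY' key ?_
    exact isSplitMono_comp _ _ inferInstance (isSplitMono_comp _ _ hf inferInstance)
  · intro hf
    refine isSplitEpi_of_map_eq hX' hY' key ?_
    exact isSplitEpi_comp _ _ inferInstance (isSplitEpi_comp _ _ hf inferInstance)

end Homotopy

/-! ## Direct summands of complexes -/

/-- The complex cut out by a degreewise retraction whose idempotents are chain maps. -/
def retractCplx (X : Cplx R) (A : ℤ → Proj R) (i : ∀ n, A n ⟶ X.X n) (r : ∀ n, X.X n ⟶ A n)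
    (hd : ∀ m n, r m ≫ i m ≫ X.d m n = X.d m n ≫ r n ≫ i n) : Cplx R where
  X := A
  d m n := i m ≫ X.d m n ≫ r n
  shape m n h := by rw [X.shape m n h]; simp
  d_comp_d' l m n _ _ := by
    simp only [Category.assoc]
    rw [reassoc_of% (hd m n), reassoc_of% (X.d_comp_d l m n)]
    simp

lemma IsMinimal.retractCplx {X : Cplx R} (hX : IsMinimal X) (A : ℤ → Proj R)
    (i : ∀ n, A n ⟶ X.X n) (r : ∀ n, X.X n ⟶ A n)
    (hd : ∀ m n, r m ≫ i m ≫ X.d m n = X.d m n ≫ r n ≫ i n) :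
    IsMinimal (retractCplx X A i r hd) :=
  fun m n => ((hX m n).comp_right _).comp_left _

/-- A degreewise direct sum decomposition that the differentials respect is a direct sum
decomposition of complexes. -/
lemma exists_biprod_iso {J : Set ℤ} {X : Cplx R} (hX : IsMinimalOn J X) (A B : ℤ → Proj R)
    (i : ∀ n, A n ⟶ X.X n) (r : ∀ n, X.X n ⟶ A n) (j : ∀ n, B n ⟶ X.X n) (s : ∀ n, X.X n ⟶ B n)
    (h₁ : ∀ n, i n ≫ r n = 𝟙 _) (h₂ : ∀ n, j n ≫ s n = 𝟙 _) (h₃ : ∀ n, i n ≫ s n = 0)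
    (h₄ : ∀ n, j n ≫ r n = 0) (h₅ : ∀ n, r n ≫ i n + s n ≫ j n = 𝟙 _)
    (h₆ : ∀ m n, i m ≫ X.d m n ≫ s n = 0) (h₇ : ∀ m n, j m ≫ X.d m n ≫ r n = 0) :
    ∃ A' B' : Cplx R, A'.X = A ∧ B'.X = B ∧ IsMinimalOn J A' ∧ IsMinimalOn J B' ∧
      Nonempty (X ≅ A' ⊞ B') := by
  have e₁ : ∀ m n, i m ≫ X.d m n = i m ≫ X.d m n ≫ r n ≫ i n := fun m n => by
    conv_lhs => rw [← Category.comp_id (i m ≫ X.d m n), ← h₅ n]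
    simp [reassoc_of% (h₆ m n)]
  have e₂ : ∀ m n, j m ≫ X.d m n = j m ≫ X.d m n ≫ s n ≫ j n := fun m n => by
    conv_lhs => rw [← Category.comp_id (j m ≫ X.d m n), ← h₅ n]
    simp [reassoc_of% (h₇ m n)]
  have hd : ∀ m n, r m ≫ i m ≫ X.d m n = X.d m n ≫ r n ≫ i n := fun m n => by
    rw [← Category.id_comp (X.d m n ≫ r n ≫ i n), ← h₅ m]
    simp [reassoc_of% (h₇ m n), ← e₁ m n]
  have hd' : ∀ m n, s m ≫ j m ≫ X.d m n = X.d m n ≫ s n ≫ j n := fun m n => by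
    rw [← Category.id_comp (X.d m n ≫ s n ≫ j n), ← h₅ m]
    simp [reassoc_of% (h₆ m n), ← e₂ m n]
  have zA : ∀ n, IsZero (X.X n) → IsZero (A n) := fun n h => by
    rw [IsZero.iff_id_eq_zero, ← h₁ n, h.eq_of_tgt (i n) 0, zero_comp]
  have zB : ∀ n, IsZero (X.X n) → IsZero (B n) := fun n h => by
    rw [IsZero.iff_id_eq_zero, ← h₂ n, h.eq_of_tgt (j n) 0, zero_comp]
  let A' := retractCplx X A i r hd
  let B' := retractCplx X B j s hd'
  let ι : A' ⟶ X := { f := i, comm' := fun m n _ => by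
                        change i m ≫ X.d m n = (i m ≫ X.d m n ≫ r n) ≫ i n
                        rw [Category.assoc, Category.assoc]
                        exact e₁ m n }
  let ρ : X ⟶ A' := { f := r, comm' := fun m n _ => by
                        change r m ≫ i m ≫ X.d m n ≫ r n = X.d m n ≫ r n
                        rw [reassoc_of% (hd m n), h₁, Category.comp_id] }
  let κ : B' ⟶ X := { f := j, comm' := fun m n _ => by
                        change j m ≫ X.d m n = (j m ≫ X.d m n ≫ s n) ≫ j n
                        rw [Category.assoc, Category.assoc]
                        exact e₂ m n }
  let τ : X ⟶ B' := { f := s, comm' := fun m n _ => by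
                        change s m ≫ j m ≫ X.d m n ≫ s n = X.d m n ≫ s n
                        rw [reassoc_of% (hd' m n), h₂, Category.comp_id] }
  have q₁ : ι ≫ ρ = 𝟙 A' := by ext1 n; exact h₁ n
  have q₂ : κ ≫ τ = 𝟙 B' := by ext1 n; exact h₂ n
  have q₃ : ι ≫ τ = 0 := by ext1 n; exact h₃ n
  have q₄ : κ ≫ ρ = 0 := by ext1 n; exact h₄ n
  have q₅ : ρ ≫ ι + τ ≫ κ = 𝟙 X := by ext1 n; exact h₅ n
  refine ⟨A', B', rfl, rfl, (hX.isMinimal.retractCplx A i r hd).isMinimalOn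
    fun n hn => zA n (hX.isZero n hn), (hX.isMinimal.retractCplx B j s hd').isMinimalOn
    fun n hn => zB n (hX.isZero n hn), ⟨⟨biprod.lift ρ τ, biprod.desc ι κ, ?_, ?_⟩⟩⟩
  · rw [biprod.lift_desc, q₅]
  · apply biprod.hom_ext' <;> apply biprod.hom_ext <;> simp [q₁, q₂, q₃, q₄]

/-- This makes the differentials respect the Fitting pieces of the components of a chain
endomorphism. -/
lemma lin_pow_comm {Y : Cplx R} (φ : Y ⟶ Y) (k : ℕ) (a b : ℤ) (x : (Y.X a).obj) :
    (lin (φ.f b) ^ k : Module.End R (Y.X b).obj) (lin (Y.d a b) x) =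
      lin (Y.d a b) ((lin (φ.f a) ^ k : Module.End R (Y.X a).obj) x) := by
  induction k generalizing x with
  | zero => rfl
  | succ k ih =>
    rw [pow_succ, pow_succ, Module.End.mul_apply, Module.End.mul_apply, ← ih]
    congr 1
    exact (LinearMap.congr_fun (congrArg lin (φ.comm a b)) x).symm

/-! ### Endomorphisms of indecomposable complexes. -/

section Local

variable [IsArtinianRing R] {J : Set ℤ} {X : Cplx R}

/-- Indecomposability in the homotopy category passes to degreewise decompositions because a minimal
complex that is zero up to homotopy has zero cells. -/
lemma IsIndecomposableOn.cells_isZero (hI : IsIndecomposableOn J X) (hX : IsMinimalOn J X)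
    (A B : ℤ → Proj R)
    (i : ∀ n, A n ⟶ X.X n) (r : ∀ n, X.X n ⟶ A n) (j : ∀ n, B n ⟶ X.X n) (s : ∀ n, X.X n ⟶ B n)
    (h₁ : ∀ n, i n ≫ r n = 𝟙 _) (h₂ : ∀ n, j n ≫ s n = 𝟙 _) (h₃ : ∀ n, i n ≫ s n = 0)
    (h₄ : ∀ n, j n ≫ r n = 0) (h₅ : ∀ n, r n ≫ i n + s n ≫ j n = 𝟙 _)
    (h₆ : ∀ m n, i m ≫ X.d m n ≫ s n = 0) (h₇ : ∀ m n, j m ≫ X.d m n ≫ r n = 0) :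
    (∀ n, IsZero (A n)) ∨ (∀ n, IsZero (B n)) := by
  obtain ⟨A', B', rfl, rfl, hA, hB, ⟨e⟩⟩ :=
    exists_biprod_iso hX A B i r j s h₁ h₂ h₃ h₄ h₅ h₆ h₇
  rcases hI.2 A' B' hA hB ⟨(Q R).mapIso e⟩ with h | h
  · exact Or.inl (isZero_of_isZero_map hA.isMinimal h)
  · exact Or.inr (isZero_of_isZero_map hB.isMinimal h)

/-- An endomorphism of an indecomposable complex is invertible or differs from the identity by
an invertible endomorphism. -/
lemma IsIndecomposableOn.isIso_or_isIso_id_sub (hI : IsIndecomposableOn J X)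
    (hX : IsMinimalOn J X) (g : (Q R).obj X ⟶ (Q R).obj X) : IsIso g ∨ IsIso (𝟙 _ - g) := by
  obtain ⟨φ, rfl⟩ := (Q R).map_surjective g
  -- The Fitting pieces form subcomplexes, so either all nilpotent parts or all invertible parts
  -- vanish.
  choose A B i r j s h hi hj hnil hiso using fun n => exists_fitting (φ.f n)
  choose N hN using hnil
  have s_range : ∀ n x, x ∈ LinearMap.range (lin (i n)) → lin (s n) x = 0 := by
    rintro n _ ⟨y, rfl⟩
    exact LinearMap.congr_fun (congrArg lin (h n).2.2.1) y
  have r_range : ∀ n x, x ∈ LinearMap.range (lin (j n)) → lin (r n) x = 0 := by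
    rintro n _ ⟨y, rfl⟩
    exact LinearMap.congr_fun (congrArg lin (h n).2.2.2.1) y
  have h₆ : ∀ m n, i m ≫ X.d m n ≫ s n = 0 := fun m n => by
    refine lin_injective (LinearMap.ext fun x => s_range n _ ?_)
    rw [hi]
    refine Submodule.mem_iSup_of_mem (N m) ?_
    change (lin (φ.f n) ^ N m : Module.End R (X.X n).obj) (lin (X.d m n) (lin (i m) x)) = 0
    rw [lin_pow_comm φ, hN, map_zero]
  have h₇ : ∀ m n, j m ≫ X.d m n ≫ r n = 0 := fun m n => by
    refine lin_injective (LinearMap.ext fun x => r_range n _ ?_)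
    have hx : lin (j m) x ∈ LinearMap.range (lin (j m)) := ⟨x, rfl⟩
    rw [hj, Submodule.mem_iInf] at hx ⊢
    intro k
    obtain ⟨y, hy⟩ := hx k
    refine ⟨lin (X.d m n) y, ?_⟩
    rw [lin_pow_comm φ, hy]
    rfl
  rcases hI.cells_isZero hX A B i r j s (fun n => (h n).1) (fun n => (h n).2.1)
    (fun n => (h n).2.2.1) (fun n => (h n).2.2.2.1) (fun n => (h n).2.2.2.2) h₆ h₇ with hz | hz
  · left
    have : ∀ n, IsIso (φ.f n) := fun n => by
      have hs : s n ≫ j n = 𝟙 _ := by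
        rw [← (h n).2.2.2.2, (hz n).eq_of_tgt (r n) 0, zero_comp, zero_add]
      have : IsIso (s n) := ⟨j n, hs, (h n).2.1⟩
      have : IsIso (j n) := ⟨s n, (h n).2.1, hs⟩
      have := hiso n
      have e : φ.f n = s n ≫ (j n ≫ φ.f n ≫ s n) ≫ j n := by
        simp only [Category.assoc, hs, reassoc_of% hs, Category.comp_id]
      rw [e]
      infer_instance
    have := HomologicalComplex.Hom.isIso_of_components φ
    infer_instance
  · right
    have : ∀ n, IsIso ((𝟙 X - φ).f n) := fun n => by
      have hr : r n ≫ i n = 𝟙 _ := by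
        rw [← (h n).2.2.2.2, (hz n).eq_of_tgt (s n) 0, zero_comp, add_zero]
      -- The exponent may depend on the degree: `1 - φ` is inverted one cell at a time.
      have hnil : IsNilpotent (lin (φ.f n) : Module.End R (X.X n).obj) := by
        refine ⟨N n, LinearMap.ext fun x => ?_⟩
        have hx : lin (i n) (lin (r n) x) = x := LinearMap.congr_fun (congrArg lin hr) x
        rw [← hx, hN]
        rfl
      exact isIso_of_bijective _ ((Module.End.isUnit_iff _).1 hnil.isUnit_one_sub)
    have := HomologicalComplex.Hom.isIso_of_components (𝟙 X - φ)
    have e : 𝟙 ((Q R).obj X) - (Q R).map φ = (Q R).map (𝟙 X - φ) := by simp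
    rw [e]
    infer_instance

end Local

/-! ## Distinguished triangles -/

/-- The triangle with the opposite third morphism. -/
abbrev negTriangle (T : Triangle (K R)) : Triangle (K R) :=
  Triangle.mk T.mor₁ T.mor₂ (-T.mor₃)

def negTriangleIso {T T' : Triangle (K R)} (e : T ≅ T') : negTriangle T ≅ negTriangle T' :=
  Triangle.isoMk (negTriangle T) (negTriangle T')
    (Triangle.π₁.mapIso e) (Triangle.π₂.mapIso e) (Triangle.π₃.mapIso e)
    e.hom.comm₁ e.hom.comm₂ (by
      have := e.hom.comm₃
      change (-T.mor₃) ≫ e.hom.hom₁⟦1⟧' = e.hom.hom₃ ≫ (-T'.mor₃)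
      rw [Preadditive.neg_comp, Preadditive.comp_neg, this])

lemma negTriangle_negTriangle (T : Triangle (K R)) : negTriangle (negTriangle T) = T :=
  congrArg (Triangle.mk T.mor₁ T.mor₂) (neg_neg T.mor₃)

lemma coneProj_eq_neg {X Y : Cplx R} (f : X ⟶ Y) :
    coneProj f = -(CochainComplex.HomComplex.Cocycle.homOf
      ((-CochainComplex.mappingCone.fst f).rightShift 1 0 (zero_add 1))) := by
  ext1 n
  simp [coneProj]
  exact (neg_neg _).symm

/-- Reconciles the two sign conventions for the third morphism of a mapping cone triangle. -/
lemma negTriangle_standard {X Y : Cplx R} (f : X ⟶ Y) :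
    negTriangle ((Q R).mapTriangle.obj (standardTriangle f)) =
      CochainComplex.mappingCone.triangleh f := by
  have h : -((Q R).map (coneProj f) ≫ ((Q R).commShiftIso (1 : ℤ)).hom.app X) =
      (Q R).map (CochainComplex.HomComplex.Cocycle.homOf
      ((-CochainComplex.mappingCone.fst f).rightShift 1 0 (zero_add 1))) ≫
      ((Q R).commShiftIso (1 : ℤ)).hom.app X := by
    rw [coneProj_eq_neg, Functor.map_neg, Preadditive.neg_comp, neg_neg]
  exact congrArg (Triangle.mk ((Q R).map f) ((Q R).map (CochainComplex.mappingCone.inr f))) h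

/-- The triangle of the homotopy category that is distinguished in the sense of Mathlib if `T` is
distinguished. -/
abbrev distTriangle (T : Triangle (Cplx R)) : Triangle (K R) :=
  negTriangle ((Q R).mapTriangle.obj T)

lemma IsDistinguished.mem {T : Triangle (Cplx R)} (h : IsDistinguished T) :
    distTriangle T ∈ distTriang (K R) := by
  obtain ⟨X, Y, f, ⟨e⟩⟩ := h
  exact isomorphic_distinguished _ (HomotopyCategory.mappingCone_triangleh_distinguished f) _
    (negTriangleIso e ≪≫ eqToIso (negTriangle_standard f))

lemma isoInK_of_iso {T T' : Triangle (Cplx R)} (e : distTriangle T ≅ distTriangle T') :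
    IsoInK T T' :=
  ⟨eqToIso (negTriangle_negTriangle _).symm ≪≫ negTriangleIso e ≪≫
    eqToIso (negTriangle_negTriangle _)⟩

/-- Identifies a given triangle with an explicit one by comparing first morphisms only. -/
lemma isoInK_of_iso₁₂ {T T' : Triangle (Cplx R)} (h : distTriangle T ∈ distTriang (K R))
    (h' : distTriangle T' ∈ distTriang (K R)) (e₁ : T.obj₁ ≅ T'.obj₁) (e₂ : T.obj₂ ≅ T'.obj₂)
    (comm : T.mor₁ ≫ e₂.hom = e₁.hom ≫ T'.mor₁) : IsoInK T T' :=
  isoInK_of_iso (isoTriangleOfIso₁₂ _ _ h h' ((Q R).mapIso e₁) ((Q R).mapIso e₂) (by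
    change (Q R).map T.mor₁ ≫ (Q R).map e₂.hom = (Q R).map e₁.hom ≫ (Q R).map T'.mor₁
    rw [← Functor.map_comp, comm, Functor.map_comp]))

/-! ### The triangle of a smonic morphism -/

namespace SmonicData

variable (D : SmonicData (Proj R))

lemma u_v : D.u ≫ D.v = 0 := by
  ext1 n
  exact biprod.inl_snd

/-- The connecting morphism of the evident degreewise splitting is `a`, that is `-w`; the sign
agrees with the one in `distTriangle`. -/
lemma dist : distTriangle D.triangle ∈ distTriang (K R) := by
  let S : ShortComplex (Cplx R) := ShortComplex.mk D.u D.v D.u_v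
  let σ : ∀ n, (S.map (HomologicalComplex.eval (Proj R) _ n)).Splitting := fun n =>
    { r := (biprod.fst : D.X n ⊞ D.Y' n ⟶ D.X n)
      s := (biprod.inr : D.Y' n ⟶ D.X n ⊞ D.Y' n)
      f_r := biprod.inl_fst
      s_g := biprod.inr_snd
      id := biprod.total }
  have hS : CochainComplex.trianglehOfDegreewiseSplit S σ ∈ distTriang (K R) :=
    (HomotopyCategory.distinguished_iff_iso_trianglehOfDegreewiseSplit _).2 ⟨S, σ, ⟨Iso.refl _⟩⟩
  have hw : CochainComplex.homOfDegreewiseSplit S σ = -D.w := by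
    ext1 n
    rw [CochainComplex.homOfDegreewiseSplit_f]
    change (biprod.inr : D.Y' n ⟶ D.X n ⊞ D.Y' n) ≫ D.cplxY.d n (n + 1) ≫
      (biprod.fst : D.X (n + 1) ⊞ D.Y' (n + 1) ⟶ D.X (n + 1)) = - -D.a n
    simp [cplxY]
  have h : -((Q R).map D.w ≫ ((Q R).commShiftIso (1 : ℤ)).hom.app D.cplxX) =
      (Q R).map (CochainComplex.homOfDegreewiseSplit S σ) ≫
      ((Q R).commShiftIso (1 : ℤ)).hom.app D.cplxX := by
    rw [hw, Functor.map_neg, Preadditive.neg_comp]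
  exact isomorphic_distinguished _ hS _
    (eqToIso (congrArg (Triangle.mk ((Q R).map D.u) ((Q R).map D.v)) h))

lemma cplxX_d (n : ℤ) : D.cplxX.d n (n + 1) = D.d n := CochainComplex.of_d _ _ _

lemma cplxW_d (n : ℤ) : D.cplxW.d n (n + 1) = D.e n := CochainComplex.of_d _ _ _

lemma cplxY_d (n : ℤ) : D.cplxY.d n (n + 1) =
    (biprod.desc (D.d n ≫ biprod.inl) (biprod.lift (D.a n) (D.e n)) :
      D.X n ⊞ D.Y' n ⟶ D.X (n + 1) ⊞ D.Y' (n + 1)) :=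
  CochainComplex.of_d (fun i => D.X i ⊞ D.Y' i) (fun i => biprod.desc (D.d i ≫ biprod.inl)
    (biprod.lift (D.a i) (D.e i))) n

lemma isMinimalOn {J : Set ℤ} (h : IsMinimalOn J D.cplxY) :
    IsMinimalOn J D.cplxX ∧ IsMinimalOn J D.cplxW := by
  have hr : ∀ n, IsRad (biprod.desc (D.d n ≫ biprod.inl) (biprod.lift (D.a n) (D.e n)) :
      D.X n ⊞ D.Y' n ⟶ D.X (n + 1) ⊞ D.Y' (n + 1)) := fun n => by
    rw [← cplxY_d]
    exact h.range_le n
  refine ⟨⟨fun n => ?_, fun n hn => ?_⟩, ⟨fun n => ?_, fun n hn => ?_⟩⟩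
  · have e : biprod.inl ≫ (biprod.desc (D.d n ≫ biprod.inl) (biprod.lift (D.a n) (D.e n)) :
      D.X n ⊞ D.Y' n ⟶ D.X (n + 1) ⊞ D.Y' (n + 1)) ≫ biprod.fst = D.d n := by simp
    change IsRad (D.cplxX.d n (n + 1))
    rw [cplxX_d, ← e]
    exact ((hr n).comp_right _).comp_left _
  · exact ((biprod_isZero_iff (D.X n) (D.Y' n)).1 (h.isZero n hn)).1
  · have e : biprod.inr ≫ (biprod.desc (D.d n ≫ biprod.inl) (biprod.lift (D.a n) (D.e n)) :
      D.X n ⊞ D.Y' n ⟶ D.X (n + 1) ⊞ D.Y' (n + 1)) ≫ biprod.snd = D.e n := by simp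
    change IsRad (D.cplxW.d n (n + 1))
    rw [cplxW_d, ← e]
    exact ((hr n).comp_right _).comp_left _
  · exact ((biprod_isZero_iff (D.X n) (D.Y' n)).1 (h.isZero n hn)).2

end SmonicData

/-! ### Standard forms of smonic and sepic maps. -/

/-- An isomorphism of complexes from isomorphisms of the cells. -/
def cplxIso {X Y : Cplx R} (f : ∀ n, X.X n ≅ Y.X n)
    (h : ∀ n, (f n).hom ≫ Y.d n (n + 1) = X.d n (n + 1) ≫ (f (n + 1)).hom) : X ≅ Y :=
  HomologicalComplex.Hom.isoOfComponents f (by rintro n _ rfl; exact h n)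

/-- The biproduct decomposition of an object given by the usual equations. -/
@[simps]
def biprodIso {M A B : Proj R} {i : A ⟶ M} {r : M ⟶ A} {j : B ⟶ M} {s : M ⟶ B}
    (h₁ : i ≫ r = 𝟙 A) (h₂ : j ≫ s = 𝟙 B) (h₃ : i ≫ s = 0) (h₄ : j ≫ r = 0)
    (h₅ : r ≫ i + s ≫ j = 𝟙 M) : M ≅ A ⊞ B where
  hom := biprod.lift r s
  inv := biprod.desc i j
  hom_inv_id := by rw [biprod.lift_desc, h₅]
  inv_hom_id := by
    apply biprod.hom_ext' <;> apply biprod.hom_ext <;> simp [h₁, h₂, h₃, h₄]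

/-- A degreewise decomposition of a complex into a subcomplex and a complement. -/
structure SubDecomp (Y : Cplx R) where
  A : ℤ → Proj R
  C : ℤ → Proj R
  i : ∀ n, A n ⟶ Y.X n
  r : ∀ n, Y.X n ⟶ A n
  j : ∀ n, C n ⟶ Y.X n
  s : ∀ n, Y.X n ⟶ C n
  i_r : ∀ n, i n ≫ r n = 𝟙 _
  j_s : ∀ n, j n ≫ s n = 𝟙 _
  i_s : ∀ n, i n ≫ s n = 0
  j_r : ∀ n, j n ≫ r n = 0
  total : ∀ n, r n ≫ i n + s n ≫ j n = 𝟙 _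
  i_d_s : ∀ n, i n ≫ Y.d n (n + 1) ≫ s (n + 1) = 0

namespace SubDecomp

variable {Y : Cplx R} (S : SubDecomp Y)

lemma comp_total {n : ℤ} {Z : Proj R} (f : Z ⟶ Y.X n) :
    f = f ≫ S.r n ≫ S.i n + f ≫ S.s n ≫ S.j n := by
  rw [← Preadditive.comp_add, S.total, Category.comp_id]

lemma i_d (n : ℤ) : S.i n ≫ Y.d n (n + 1) = S.i n ≫ Y.d n (n + 1) ≫ S.r (n + 1) ≫ S.i (n + 1) := by
  conv_lhs => rw [S.comp_total (S.i n ≫ Y.d n (n + 1))]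
  simp [reassoc_of% (S.i_d_s n)]

lemma d_s (n : ℤ) : Y.d n (n + 1) ≫ S.s (n + 1) = S.s n ≫ S.j n ≫ Y.d n (n + 1) ≫ S.s (n + 1) := by
  conv_lhs => rw [← Category.id_comp (Y.d n (n + 1) ≫ S.s (n + 1)), ← S.total]
  simp [S.i_d_s]

/-- The standard form of the complex. -/
def data : SmonicData (Proj R) where
  X := S.A
  Y' := S.C
  d n := S.i n ≫ Y.d n (n + 1) ≫ S.r (n + 1)
  a n := S.j n ≫ Y.d n (n + 1) ≫ S.r (n + 1)
  e n := S.j n ≫ Y.d n (n + 1) ≫ S.s (n + 1)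
  d_d n := by
    simp only [Category.assoc]
    rw [← reassoc_of% (S.i_d n)]
    simp
  e_e n := by
    have := S.d_s (n + 1)
    simp only [Category.assoc]
    rw [← this]
    simp
  a_d n := by
    have := S.comp_total (S.j n ≫ Y.d n (n + 1))
    have h : (S.j n ≫ Y.d n (n + 1)) ≫ Y.d (n + 1) (n + 1 + 1) ≫ S.r (n + 1 + 1) = 0 := by simp
    rw [this] at h
    simpa using h

/-- The isomorphism of the complex with its standard form. -/
def iso : Y ≅ S.data.cplxY :=
  cplxIso (fun n => biprodIso (S.i_r n) (S.j_s n) (S.i_s n) (S.j_r n) (S.total n))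
    (fun n => by
      rw [SmonicData.cplxY_d]
      have h : (S.r n ≫ S.i n + S.s n ≫ S.j n) ≫ Y.d n (n + 1) ≫ S.r (n + 1) =
        Y.d n (n + 1) ≫ S.r (n + 1) := by rw [S.total, Category.id_comp]
      have key : (biprod.lift (S.r n) (S.s n) : Y.X n ⟶ S.A n ⊞ S.C n) ≫
          biprod.desc ((S.i n ≫ Y.d n (n + 1) ≫ S.r (n + 1)) ≫ biprod.inl)
            (biprod.lift (S.j n ≫ Y.d n (n + 1) ≫ S.r (n + 1))
              (S.j n ≫ Y.d n (n + 1) ≫ S.s (n + 1))) =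
          Y.d n (n + 1) ≫ biprod.lift (S.r (n + 1)) (S.s (n + 1)) := by
        apply biprod.hom_ext
        · simpa using h
        · simpa using (S.d_s n).symm
      exact key)

lemma isMinimalOn_data {J : Set ℤ} (h : IsMinimalOn J Y) :
    IsMinimalOn J S.data.cplxX ∧ IsMinimalOn J S.data.cplxY ∧ IsMinimalOn J S.data.cplxW := by
  have hY : IsMinimalOn J S.data.cplxY := (isMinimal_of_isIso h.isMinimal S.iso.hom).isMinimalOn
    fun n hn => (h.isZero n hn).of_iso
      ((HomologicalComplex.eval _ _ n).mapIso S.iso.symm)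
  exact ⟨(S.data.isMinimalOn hY).1, hY, (S.data.isMinimalOn hY).2⟩

end SubDecomp

/-- The decomposition given by a smonic morphism. -/
lemma IsSmonic.exists_subDecomp {X Y : Cplx R} {f : X ⟶ Y} (hf : IsSmonic f) :
    ∃ (S : SubDecomp Y) (e : X ≅ S.data.cplxX), f ≫ S.iso.hom = e.hom ≫ S.data.u := by
  have := hf
  choose C j s h using fun n => have := hf n
    exists_complement (f.f n) (retraction (f.f n)) (IsSplitMono.id _)
  let S : SubDecomp Y :=
    { A := X.X
      C := C
      i := f.f
      r := fun n => have := hf n; retraction (f.f n)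
      j := j
      s := s
      i_r := fun n => have := hf n; IsSplitMono.id _
      j_s := fun n => (h n).1
      i_s := fun n => (h n).2.1
      j_r := fun n => (h n).2.2.1
      total := fun n => (h n).2.2.2
      i_d_s := fun n => by rw [f.comm_assoc, (h _).2.1, comp_zero] }
  refine ⟨S, cplxIso (fun n => Iso.refl _) (fun n => ?_), ?_⟩
  · rw [SmonicData.cplxX_d]
    have := S.i_r (n + 1)
    change 𝟙 _ ≫ f.f n ≫ Y.d n (n + 1) ≫ S.r (n + 1) = X.d n (n + 1) ≫ 𝟙 _
    rw [f.comm_assoc, Category.id_comp]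
    exact congrArg _ this
  · ext1 n
    have key : S.i n ≫ biprod.lift (S.r n) (S.s n) = 𝟙 (S.A n) ≫ biprod.inl := by
      apply biprod.hom_ext
      · simpa using S.i_r n
      · simpa using S.i_s n
    exact key

/-- The decomposition given by a sepic morphism. -/
lemma IsSepic.exists_subDecomp {Y Z : Cplx R} {g : Y ⟶ Z} (hg : IsSepic g) :
    ∃ (S : SubDecomp Y) (e : Z ≅ S.data.cplxW), g ≫ e.hom = S.iso.hom ≫ S.data.v := by
  choose A i r h using fun n => have := hg n
    exists_complement (section_ (g.f n)) (g.f n) (IsSplitEpi.id _)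
  let S : SubDecomp Y :=
    { A := A
      C := Z.X
      i := i
      r := r
      j := fun n => have := hg n; section_ (g.f n)
      s := g.f
      i_r := fun n => (h n).1
      j_s := fun n => have := hg n; IsSplitEpi.id _
      i_s := fun n => (h n).2.2.1
      j_r := fun n => (h n).2.1
      total := fun n => by rw [add_comm]; exact (h n).2.2.2
      i_d_s := fun n => by rw [← g.comm, reassoc_of% ((h n).2.2.1), zero_comp] }
  refine ⟨S, cplxIso (fun n => Iso.refl _) (fun n => ?_), ?_⟩
  · rw [SmonicData.cplxW_d]
    have := S.j_s n
    change 𝟙 _ ≫ S.j n ≫ Y.d n (n + 1) ≫ g.f (n + 1) = Z.d n (n + 1) ≫ 𝟙 _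
    rw [← g.comm, Category.id_comp, Category.comp_id, ← Category.assoc]
    exact (congrArg (· ≫ Z.d n (n + 1)) this).trans (Category.id_comp _)
  · ext1 n
    change g.f n ≫ 𝟙 _ = biprod.lift (S.r n) (S.s n) ≫ biprod.snd
    rw [biprod.lift_snd, Category.comp_id]

/-! ### The triangles with graded pieces `A`, `E`, `B` -/

namespace ConeData

variable (D : ConeData (Proj R))

lemma cplxX_d (n : ℤ) : D.cplxX.d n (n + 1) =
    (biprod.desc (biprod.lift (D.α n) (D.b n)) (D.e n ≫ biprod.inr) :
      D.A n ⊞ D.E n ⟶ D.A (n + 1) ⊞ D.E (n + 1)) :=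
  CochainComplex.of_d (fun i => D.A i ⊞ D.E i)
    (fun i => biprod.desc (biprod.lift (D.α i) (D.b i)) (D.e i ≫ biprod.inr)) n

lemma cplxY_d (n : ℤ) : D.cplxY.d n (n + 1) =
    (biprod.desc (biprod.lift (D.α n) (D.b n ≫ D.f (n + 1))) (D.β n ≫ biprod.inr) :
      D.A n ⊞ D.B n ⟶ D.A (n + 1) ⊞ D.B (n + 1)) :=
  CochainComplex.of_d (fun i => D.A i ⊞ D.B i)
    (fun i => biprod.desc (biprod.lift (D.α i) (D.b i ≫ D.f (i + 1))) (D.β i ≫ biprod.inr)) n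

lemma cplxW_d (n : ℤ) : D.cplxW.d n (n + 1) =
    (biprod.desc (biprod.lift (-D.e (n + 1)) (D.f (n + 1))) (D.β n ≫ biprod.inr) :
      D.E (n + 1) ⊞ D.B n ⟶ D.E (n + 1 + 1) ⊞ D.B (n + 1)) :=
  CochainComplex.of_d (fun i => D.E (i + 1) ⊞ D.B i)
    (fun i => biprod.desc (biprod.lift (-D.e (i + 1)) (D.f (i + 1))) (D.β i ≫ biprod.inr)) n

/-- The data of the degreewise split exact sequence that replaces `cplxY` by the cylinder. -/
def cylinder : SmonicData (Proj R) where
  X i := D.A i ⊞ D.E i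
  Y' i := D.E (i + 1) ⊞ D.B i
  d i := biprod.desc (biprod.lift (D.α i) (D.b i)) (D.e i ≫ biprod.inr)
  a i := -(biprod.fst ≫ biprod.inr)
  e i := biprod.desc (biprod.lift (-D.e (i + 1)) (D.f (i + 1))) (D.β i ≫ biprod.inr)
  d_d i := by
    apply biprod.hom_ext' <;> apply biprod.hom_ext <;> simp [D.α_α, D.e_e, D.α_b]
  e_e i := by
    apply biprod.hom_ext' <;> apply biprod.hom_ext <;> simp [D.e_e, D.β_β, D.f_β]
  a_d i := by
    apply biprod.hom_ext' <;> apply biprod.hom_ext <;> simp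

/-- The differential of the cylinder. -/
abbrev cylinderD (n : ℤ) : (D.A n ⊞ D.E n) ⊞ (D.E (n + 1) ⊞ D.B n) ⟶
    (D.A (n + 1) ⊞ D.E (n + 1)) ⊞ (D.E (n + 1 + 1) ⊞ D.B (n + 1)) :=
  biprod.desc ((biprod.desc (biprod.lift (D.α n) (D.b n)) (D.e n ≫ biprod.inr)) ≫ biprod.inl)
    (biprod.lift (-(biprod.fst ≫ biprod.inr))
      (biprod.desc (biprod.lift (-D.e (n + 1)) (D.f (n + 1))) (D.β n ≫ biprod.inr)))

lemma cylinder_cplxY_d (n : ℤ) : D.cylinder.cplxY.d n (n + 1) = D.cylinderD n :=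
  D.cylinder.cplxY_d n

/-- The cell of the projection of the cylinder to `cplxY`. -/
abbrev projCell (n : ℤ) : (D.A n ⊞ D.E n) ⊞ (D.E (n + 1) ⊞ D.B n) ⟶ D.A n ⊞ D.B n :=
  biprod.desc (biprod.map (𝟙 _) (D.f n)) (biprod.snd ≫ biprod.inr)

/-- The cell of the inclusion of `cplxY` into the cylinder. -/
abbrev inclCell (n : ℤ) : D.A n ⊞ D.B n ⟶ (D.A n ⊞ D.E n) ⊞ (D.E (n + 1) ⊞ D.B n) :=
  biprod.desc (biprod.lift biprod.inl (D.b n ≫ biprod.inl)) (biprod.inr ≫ biprod.inr)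

/-- The projection of the cylinder to `cplxY`. -/
def cylinderProj : D.cylinder.cplxY ⟶ D.cplxY :=
  CochainComplex.ofHom (fun n => D.projCell n) (fun n => by
    rw [cplxY_d, cylinder_cplxY_d]
    have key : D.projCell n ≫
        biprod.desc (biprod.lift (D.α n) (D.b n ≫ D.f (n + 1))) (D.β n ≫ biprod.inr) =
        D.cylinderD n ≫
          D.projCell (n + 1) := by
      apply biprod.hom_ext' <;> apply biprod.hom_ext' <;> apply biprod.hom_ext <;>
        simp [projCell, D.f_β]
    exact key)

/-- The inclusion of `cplxY` into the cylinder. -/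
def cylinderIncl : D.cplxY ⟶ D.cylinder.cplxY :=
  CochainComplex.ofHom (fun n => D.inclCell n) (fun n => by
    rw [cplxY_d, cylinder_cplxY_d]
    have h : D.α n ≫ D.b (n + 1) = -D.b n ≫ D.e (n + 1) := by
      simpa using eq_neg_of_add_eq_zero_left (D.α_b n)
    have key : D.inclCell n ≫
        D.cylinderD n =
        biprod.desc (biprod.lift (D.α n) (D.b n ≫ D.f (n + 1))) (D.β n ≫ biprod.inr) ≫
          D.inclCell (n + 1) := by
      apply biprod.hom_ext' <;> apply biprod.hom_ext <;> apply biprod.hom_ext <;>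
        simp [inclCell, h]
    exact key)

end ConeData

/-- Writing every degree as `n + 1` avoids transport along `n - 1 + 1 = n`. -/
lemma map_eq_of_homotopy {X Y : Cplx R} (f g : X ⟶ Y) (h : ∀ n : ℤ, X.X (n + 1) ⟶ Y.X n)
    (H : ∀ n, f.f (n + 1) = X.d (n + 1) (n + 1 + 1) ≫ h (n + 1) + h n ≫ Y.d n (n + 1) +
      g.f (n + 1)) : (Q R).map f = (Q R).map g := by
  let h' : ∀ i j, X.X i ⟶ Y.X j := fun i j =>
    if hij : j + 1 = i then eqToHom (by rw [hij]) ≫ h j else 0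
  have hh : ∀ n, h' (n + 1) n = h n := fun n => by simp [h']
  refine HomotopyCategory.eq_of_homotopy f g
    { hom := h'
      zero := fun i j hij => dif_neg hij
      comm := fun n => ?_ }
  obtain ⟨n, rfl⟩ : ∃ m, n = m + 1 := ⟨n - 1, by simp⟩
  rw [dNext_eq h' (show (ComplexShape.up ℤ).Rel (n + 1) (n + 1 + 1) from rfl),
    prevD_eq h' (show (ComplexShape.up ℤ).Rel n (n + 1) from rfl), hh, hh]
  exact H n

namespace ConeData

variable (D : ConeData (Proj R))

lemma cylinderIncl_proj : D.cylinderIncl ≫ D.cylinderProj = 𝟙 _ := by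
  ext1 n
  have key : D.inclCell n ≫ D.projCell n = 𝟙 _ := by
    apply biprod.hom_ext' <;> simp [inclCell, projCell]
  exact key

/-- The homotopy that contracts the cylinder to `cplxY`. -/
abbrev cylinderH (n : ℤ) : (D.A (n + 1) ⊞ D.E (n + 1)) ⊞ (D.E (n + 1 + 1) ⊞ D.B (n + 1)) ⟶
    (D.A n ⊞ D.E n) ⊞ (D.E (n + 1) ⊞ D.B n) :=
  biprod.fst ≫ biprod.snd ≫ biprod.inl ≫ biprod.inr

lemma map_cylinderProj_incl :
    (Q R).map (D.cylinderProj ≫ D.cylinderIncl) = (Q R).map (𝟙 _) := by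
  have key : ∀ n : ℤ, D.projCell (n + 1) ≫ D.inclCell (n + 1) =
      D.cylinderD (n + 1) ≫ D.cylinderH (n + 1) + D.cylinderH n ≫ D.cylinderD n + 𝟙 _ := by
    intro n
    apply biprod.hom_ext' <;> apply biprod.hom_ext' <;> apply biprod.hom_ext <;>
      apply biprod.hom_ext <;> simp [projCell, inclCell, cylinderD, cylinderH]
  refine map_eq_of_homotopy _ _ (fun n => D.cylinderH n) (fun n => ?_)
  rw [cylinder_cplxY_d, cylinder_cplxY_d]
  exact key n

/-- In the cylinder, `E^(n+1)` in degree `n` cancels against `E^(n+1)` in degree `n + 1`, which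
leaves `cplxY`. This homotopy equivalence carries the degreewise split triangle of the cylinder to
the triangle of `D`. -/
lemma dist : distTriangle D.triangle ∈ distTriang (K R) := by
  have h₁ : D.cylinder.u ≫ D.cylinderProj = D.u := by
    ext1 n
    have key : biprod.inl ≫ D.projCell n = biprod.map (𝟙 _) (D.f n) := biprod.inl_desc _ _
    exact key
  have h₂ : D.cylinderIncl ≫ D.cylinder.v = D.v := by
    ext1 n
    have key : D.inclCell n ≫ biprod.snd = biprod.map (D.b n) (𝟙 _) := by
      apply biprod.hom_ext' <;> simp [inclCell]
    exact key
  have h₃ : D.cylinder.w = D.w := by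
    ext1 n
    have key : - -(biprod.fst ≫ biprod.inr : D.E (n + 1) ⊞ D.B n ⟶ D.A (n + 1) ⊞ D.E (n + 1)) =
      biprod.fst ≫ biprod.inr := neg_neg _
    exact key
  let e₂ : (Q R).obj D.cylinder.cplxY ≅ (Q R).obj D.cplxY :=
    { hom := (Q R).map D.cylinderProj
      inv := (Q R).map D.cylinderIncl
      hom_inv_id := by rw [← Functor.map_comp, map_cylinderProj_incl, CategoryTheory.Functor.map_id]
      inv_hom_id := by rw [← Functor.map_comp, cylinderIncl_proj, CategoryTheory.Functor.map_id] }
  refine isomorphic_distinguished _ D.cylinder.dist _ (Iso.symm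
    (Triangle.isoMk (distTriangle D.cylinder.triangle) (distTriangle D.triangle)
    (Iso.refl _) e₂ (Iso.refl _) ?_ ?_ ?_))
  · change (Q R).map D.cylinder.u ≫ (Q R).map D.cylinderProj = 𝟙 _ ≫ (Q R).map D.u
    rw [← Functor.map_comp, h₁]
    exact (Category.id_comp _).symm
  · change (Q R).map D.cylinder.v ≫ 𝟙 _ = (Q R).map D.cylinderProj ≫ (Q R).map D.v
    have h : (Q R).map D.cylinderProj ≫ (Q R).map (D.cylinderIncl ≫ D.cylinder.v) =
        (Q R).map D.cylinder.v := by
      rw [Functor.map_comp, ← Category.assoc, ← Functor.map_comp, map_cylinderProj_incl,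
        CategoryTheory.Functor.map_id, Category.id_comp]
    exact (Category.comp_id _).trans
      (h.symm.trans (congrArg (fun t => (Q R).map D.cylinderProj ≫ (Q R).map t) h₂))
  · have h : -((Q R).map D.cylinder.w ≫ ((Q R).commShiftIso (1 : ℤ)).hom.app D.cplxX) =
      -((Q R).map D.w ≫ ((Q R).commShiftIso (1 : ℤ)).hom.app D.cplxX) :=
      congrArg (fun t : D.cplxW ⟶ D.cplxX⟦(1 : ℤ)⟧ =>
        -((Q R).map t ≫ ((Q R).commShiftIso (1 : ℤ)).hom.app D.cplxX)) h₃
    change (-((Q R).map D.cylinder.w ≫ ((Q R).commShiftIso (1 : ℤ)).hom.app D.cplxX)) ≫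
      (shiftFunctor (K R) (1 : ℤ)).map (𝟙 _) = 𝟙 _ ≫
      (-((Q R).map D.w ≫ ((Q R).commShiftIso (1 : ℤ)).hom.app D.cplxX))
    rw [h, CategoryTheory.Functor.map_id]
    exact (Category.comp_id _).trans (Category.id_comp _).symm

end ConeData

/-! ### The standard form `1 ⊞ f` of a chain map. -/

/-- Degreewise decompositions under which a chain map becomes `1 ⊞ f`. -/
structure MapDecomp {X Y : Cplx R} (u : X ⟶ Y) where
  A : ℤ → Proj R
  E : ℤ → Proj R
  B : ℤ → Proj R
  f : ∀ n, E n ⟶ B n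
  isoX : ∀ n, X.X n ≅ A n ⊞ E n
  isoY : ∀ n, Y.X n ≅ A n ⊞ B n
  comm : ∀ n, u.f n ≫ (isoY n).hom = (isoX n).hom ≫ biprod.map (𝟙 _) (f n)
  -- Kills the component `B n ⟶ A (n + 1)` of the differential of `Y`, making it triangular.
  isZero : ∀ n, IsZero (B n) ∨ IsZero (A (n + 1))

namespace MapDecomp

variable {X Y : Cplx R} {u : X ⟶ Y} (M : MapDecomp u)

/-- The differential of the source in terms of the decomposition. -/
def dX (n : ℤ) : M.A n ⊞ M.E n ⟶ M.A (n + 1) ⊞ M.E (n + 1) :=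
  (M.isoX n).inv ≫ X.d n (n + 1) ≫ (M.isoX (n + 1)).hom

/-- The differential of the target in terms of the decomposition. -/
def dY (n : ℤ) : M.A n ⊞ M.B n ⟶ M.A (n + 1) ⊞ M.B (n + 1) :=
  (M.isoY n).inv ≫ Y.d n (n + 1) ≫ (M.isoY (n + 1)).hom

lemma dX_dX (n : ℤ) : M.dX n ≫ M.dX (n + 1) = 0 := by simp [dX]

lemma dY_dY (n : ℤ) : M.dY n ≫ M.dY (n + 1) = 0 := by simp [dY]

lemma comm' (n : ℤ) : biprod.map (𝟙 _) (M.f n) ≫ M.dY n =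
    M.dX n ≫ biprod.map (𝟙 _) (M.f (n + 1)) := by
  rw [← cancel_epi (M.isoX n).hom]
  simp only [dX, dY, Category.assoc, Iso.hom_inv_id_assoc]
  rw [← reassoc_of% (M.comm n), ← M.comm (n + 1)]
  simp

lemma inr_dY_fst (n : ℤ) : biprod.inr ≫ M.dY n ≫ biprod.fst = 0 :=
  (M.isZero n).elim (fun h => h.eq_of_src _ _) (fun h => h.eq_of_tgt _ _)

/-- As `1 ⊞ f` is the identity on `A`, this component equals `f` followed by the vanishing component
`B n ⟶ A (n + 1)`. -/
lemma inr_dX_fst (n : ℤ) : biprod.inr ≫ M.dX n ≫ biprod.fst = 0 := by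
  have := congrArg (fun t => biprod.inr ≫ t ≫ biprod.fst) (M.comm' n)
  simp only [Category.assoc, biprod.map_fst, biprod.inr_map_assoc, M.inr_dY_fst,
    Category.comp_id] at this
  rw [← this, comp_zero]

lemma dX_eq (n : ℤ) : M.dX n =
    biprod.desc (biprod.lift (biprod.inl ≫ M.dX n ≫ biprod.fst) (biprod.inl ≫ M.dX n ≫ biprod.snd))
      ((biprod.inr ≫ M.dX n ≫ biprod.snd) ≫ biprod.inr) := by
  apply biprod.hom_ext' <;> apply biprod.hom_ext <;> simp [M.inr_dX_fst]

lemma dY_eq (n : ℤ) : M.dY n =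
    biprod.desc (biprod.lift (biprod.inl ≫ M.dX n ≫ biprod.fst)
      ((biprod.inl ≫ M.dX n ≫ biprod.snd) ≫ M.f (n + 1)))
      ((biprod.inr ≫ M.dY n ≫ biprod.snd) ≫ biprod.inr) := by
  have h₁ := congrArg (fun t => biprod.inl ≫ t ≫ biprod.fst) (M.comm' n)
  have h₂ := congrArg (fun t => biprod.inl ≫ t ≫ biprod.snd) (M.comm' n)
  simp only [Category.assoc, biprod.map_fst, biprod.map_snd, biprod.inl_map_assoc,
    Category.id_comp, Category.comp_id] at h₁ h₂
  apply biprod.hom_ext' <;> apply biprod.hom_ext <;> simp [M.inr_dY_fst, h₁, h₂]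

/-- The standard form of the chain map. -/
def data : ConeData (Proj R) where
  A := M.A
  E := M.E
  B := M.B
  α n := biprod.inl ≫ M.dX n ≫ biprod.fst
  b n := biprod.inl ≫ M.dX n ≫ biprod.snd
  e n := biprod.inr ≫ M.dX n ≫ biprod.snd
  β n := biprod.inr ≫ M.dY n ≫ biprod.snd
  f := M.f
  α_α n := by
    have h := M.dX_dX n
    rw [M.dX_eq n, M.dX_eq (n + 1)] at h
    simpa using congrArg (fun t => biprod.inl ≫ t ≫ biprod.fst) h
  e_e n := by
    have h := M.dX_dX n
    rw [M.dX_eq n, M.dX_eq (n + 1)] at h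
    simpa using congrArg (fun t => biprod.inr ≫ t ≫ biprod.snd) h
  β_β n := by
    have h := M.dY_dY n
    rw [M.dY_eq n, M.dY_eq (n + 1)] at h
    simpa using congrArg (fun t => biprod.inr ≫ t ≫ biprod.snd) h
  α_b n := by
    have h := M.dX_dX n
    rw [M.dX_eq n, M.dX_eq (n + 1)] at h
    simpa using congrArg (fun t => biprod.inl ≫ t ≫ biprod.snd) h
  f_β n := by
    simpa using congrArg (fun t => biprod.inr ≫ t ≫ biprod.snd) (M.comm' n)

/-- The source is isomorphic to its standard form. -/
def iso₁ : X ≅ M.data.cplxX :=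
  cplxIso M.isoX (fun n => by
    rw [ConeData.cplxX_d]
    have h : (M.isoX n).hom ≫ M.dX n = X.d n (n + 1) ≫ (M.isoX (n + 1)).hom := by simp [dX]
    rw [M.dX_eq n] at h
    exact h)

/-- The target is isomorphic to its standard form. -/
def iso₂ : Y ≅ M.data.cplxY :=
  cplxIso M.isoY (fun n => by
    rw [ConeData.cplxY_d]
    have h : (M.isoY n).hom ≫ M.dY n = Y.d n (n + 1) ≫ (M.isoY (n + 1)).hom := by simp [dY]
    rw [M.dY_eq n] at h
    exact h)

lemma comm_iso : u ≫ M.iso₂.hom = M.iso₁.hom ≫ M.data.u := by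
  ext1 n
  exact M.comm n

end MapDecomp

/-! ## Auslander-Reiten triangles -/

lemma IsIndecomposableOn.of_iso {J : Set ℤ} {X X' : Cplx R} (h : IsIndecomposableOn J X)
    (e : (Q R).obj X ≅ (Q R).obj X') : IsIndecomposableOn J X' :=
  ⟨fun hz => h.1 (hz.of_iso e), fun A B hA hB ⟨e'⟩ => h.2 A B hA hB ⟨e ≪≫ e'⟩⟩

namespace IsARTriangle

variable {J : Set ℤ} {T T' : Triangle (Cplx R)}

lemma of_isoOn (hT : IsARTriangle J T) (h : IsoOn J T T') : IsARTriangle J T' := by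
  obtain ⟨h₁, h₂, h₃, ⟨e⟩⟩ := h
  let e₁ : (Q R).obj T.obj₁ ≅ (Q R).obj T'.obj₁ := Triangle.π₁.mapIso e
  let e₂ : (Q R).obj T.obj₂ ≅ (Q R).obj T'.obj₂ := Triangle.π₂.mapIso e
  let e₃ : (Q R).obj T.obj₃ ≅ (Q R).obj T'.obj₃ := Triangle.π₃.mapIso e
  have c₂ : (Q R).map T.mor₂ ≫ e₃.hom = e₂.hom ≫ (Q R).map T'.mor₂ := e.hom.comm₂
  have c₃ : ((Q R).map T.mor₃ ≫ ((Q R).commShiftIso (1 : ℤ)).hom.app T.obj₁) ≫ e₁.hom⟦1⟧' =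
    e₃.hom ≫ (Q R).map T'.mor₃ ≫ ((Q R).commShiftIso (1 : ℤ)).hom.app T'.obj₁ := e.hom.comm₃
  refine ⟨h₁, h₂, h₃, ?_, hT.indecomposable₁.of_iso e₁, hT.indecomposable₃.of_iso e₃,
    fun h0 => hT.mor₃_ne_zero ?_, fun W hW f hf => ?_⟩
  · obtain ⟨X, Y, f, ⟨e'⟩⟩ := hT.distinguished
    exact ⟨X, Y, f, ⟨e.symm ≪≫ e'⟩⟩
  · rw [h0, zero_comp, comp_zero, ← cancel_mono (inv (e₁.hom⟦(1 : ℤ)⟧'))] at c₃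
    rw [← cancel_mono (((Q R).commShiftIso (1 : ℤ)).hom.app T.obj₁)]
    simpa using c₃
  · obtain ⟨g, hg⟩ := hT.exists_lift W hW (f ≫ e₃.inv) (fun hs => hf (by
      have := isSplitEpi_comp (f ≫ e₃.inv) e₃.hom hs inferInstance
      simpa using this))
    exact ⟨g ≫ e₂.hom, by rw [Category.assoc, ← c₂, reassoc_of% hg, e₃.inv_hom_id,
      Category.comp_id]⟩

lemma mor₃_ne (hT : IsARTriangle J T) : (distTriangle T).mor₃ ≠ 0 := by
  intro h
  apply hT.mor₃_ne_zero
  have h' : (Q R).map T.mor₃ ≫ ((Q R).commShiftIso (1 : ℤ)).hom.app T.obj₁ = 0 :=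
    neg_eq_zero.1 h
  rw [← cancel_mono (((Q R).commShiftIso (1 : ℤ)).hom.app T.obj₁), h', zero_comp]

lemma comp_zero₁₂ (hT : IsARTriangle J T) : (Q R).map T.mor₁ ≫ (Q R).map T.mor₂ = 0 :=
  comp_distTriang_mor_zero₁₂ _ hT.distinguished.mem

variable [IsArtinianRing R]

/-- The second morphism is right minimal. -/
lemma isIso_of_comp_eq (hT : IsARTriangle J T) (θ : (Q R).obj T.obj₂ ⟶ (Q R).obj T.obj₂)
    (h : θ ≫ (Q R).map T.mor₂ = (Q R).map T.mor₂) : IsIso θ := by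
  have hd := hT.distinguished.mem
  -- The endomorphism `(g, θ, 1)` of the triangle gives `w ≫ g⟦1⟧ = w`. If `g` is invertible, so is
  -- `θ`; if `1 - g` is invertible, then `w = 0`.
  obtain ⟨g, hg₁, hg₃⟩ := complete_distinguished_triangle_morphism₁ _ _ hd hd θ (𝟙 _)
    ((Category.comp_id _).trans h.symm)
  rcases hT.indecomposable₁.isIso_or_isIso_id_sub hT.mem₁ g with hi | hi
  · exact isIso₂_of_isIso₁₃ (Triangle.homMk (distTriangle T) (distTriangle T) g θ (𝟙 _) hg₁
      ((Category.comp_id _).trans h.symm) hg₃) hd hd hi (IsIso.id _)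
  · exfalso
    apply hT.mor₃_ne
    have h0 : (distTriangle T).mor₃ ≫ (𝟙 _ - g)⟦(1 : ℤ)⟧' = 0 := by
      rw [Functor.map_sub, Preadditive.comp_sub, hg₃, CategoryTheory.Functor.map_id,
        Category.comp_id, Category.id_comp, sub_self]
    have : IsIso (𝟙 (distTriangle T).obj₁ - g) := hi
    exact (cancel_mono ((𝟙 (distTriangle T).obj₁ - g)⟦(1 : ℤ)⟧')).1 (h0.trans zero_comp.symm)

/-- The second morphism is irreducible. -/
lemma isSplitMono_or_isSplitEpi (hT : IsARTriangle J T) {W : Cplx R} (hW : IsMinimalOn J W)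
    (p : (Q R).obj T.obj₂ ⟶ (Q R).obj W) (q : (Q R).obj W ⟶ (Q R).obj T.obj₃)
    (h : p ≫ q = (Q R).map T.mor₂) : IsSplitMono p ∨ IsSplitEpi q := by
  by_cases hq : IsSplitEpi q
  · exact Or.inr hq
  -- If `q` lifts through `v` as `t`, then `p ≫ t` fixes `v` and is invertible by right minimality.
  · obtain ⟨t, ht⟩ := hT.exists_lift W hW q hq
    exact Or.inl (isSplitMono_of_isIso_comp p t
      (hT.isIso_of_comp_eq (p ≫ t) (by rw [Category.assoc, ht, h])))

lemma isSmonic_or_isSepic (hT : IsARTriangle J T) {W : Cplx R} (hW : IsMinimalOn J W)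
    (p : T.obj₂ ⟶ W) (q : W ⟶ T.obj₃) (h : (Q R).map (p ≫ q) = (Q R).map T.mor₂) :
    IsSmonic p ∨ IsSepic q := by
  rw [Functor.map_comp] at h
  exact (hT.isSplitMono_or_isSplitEpi hW _ _ h).imp
    (isSmonic_of_isSplitMono hT.mem₂.isMinimal) (isSepic_of_isSplitEpi hT.mem₃.isMinimal)

/-- If the first morphism is smonic, the triangle is isomorphic to one in standard form. -/
lemma of_isSmonic (hT : IsARTriangle J T) (h : IsSmonic T.mor₁) :
    IsSepic T.mor₂ ∧ HasShapeSmonic J T := by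
  obtain ⟨S, e, he⟩ := h.exists_subDecomp
  obtain ⟨h₁, h₂, h₃⟩ := S.isMinimalOn_data hT.mem₂
  have hiso : IsoInK T S.data.triangle :=
    isoInK_of_iso₁₂ hT.distinguished.mem S.data.dist e S.iso he
  refine ⟨fun n => ?_, S.data, h₁, h₂, h₃, hiso⟩
  obtain ⟨i⟩ := hiso
  refine (exists_isos_of_square h₂.isMinimal h₃.isMinimal hT.mem₂.isMinimal hT.mem₃.isMinimal
    S.data.v T.mor₂ (Triangle.π₂.mapIso i.symm) (Triangle.π₃.mapIso i.symm)
    i.symm.hom.comm₂ n).2 ?_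
  exact inferInstanceAs (IsSplitEpi (biprod.snd : S.A n ⊞ S.C n ⟶ S.C n))

/-- If the second morphism is sepic, the first one is smonic. -/
lemma isSmonic_of_isSepic (hT : IsARTriangle J T) (h : IsSepic T.mor₂) : IsSmonic T.mor₁ := by
  obtain ⟨S, e, he⟩ := h.exists_subDecomp
  obtain ⟨h₁, h₂, h₃⟩ := S.isMinimalOn_data hT.mem₂
  have comm : (distTriangle T).mor₂ ≫ (Q R).map e.hom =
      (Q R).map S.iso.hom ≫ (distTriangle S.data.triangle).mor₂ := by
    change (Q R).map T.mor₂ ≫ (Q R).map e.hom = (Q R).map S.iso.hom ≫ (Q R).map S.data.v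
    rw [← Functor.map_comp, he, Functor.map_comp]
  obtain ⟨a, ha₁, ha₃⟩ := complete_distinguished_triangle_morphism₁ _ _ hT.distinguished.mem
    S.data.dist ((Q R).map S.iso.hom) ((Q R).map e.hom) comm
  have : IsIso a := isIso₁_of_isIso₂₃ (Triangle.homMk (distTriangle T)
    (distTriangle S.data.triangle) a ((Q R).map S.iso.hom) ((Q R).map e.hom) ha₁ comm ha₃)
    hT.distinguished.mem S.data.dist (inferInstanceAs (IsIso ((Q R).map S.iso.hom)))
    (inferInstanceAs (IsIso ((Q R).map e.hom)))
  let e₁ : (Q R).obj T.obj₁ ≅ (Q R).obj S.data.cplxX := @asIso _ _ _ _ a this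
  have key : (Q R).map S.data.u ≫ ((Q R).mapIso S.iso).inv = e₁.inv ≫ (Q R).map T.mor₁ := by
    rw [Iso.comp_inv_eq, Category.assoc, Iso.eq_inv_comp]
    exact ha₁.symm
  intro n
  refine (exists_isos_of_square h₁.isMinimal h₂.isMinimal hT.mem₁.isMinimal hT.mem₂.isMinimal
    S.data.u T.mor₁ e₁.symm ((Q R).mapIso S.iso).symm key n).1 ?_
  exact inferInstanceAs (IsSplitMono (biprod.inl : S.A n ⟶ S.A n ⊞ S.C n))

/-- A complex over the first object on which the first morphism becomes smonic is zero, unless the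
first morphism is smonic. -/
lemma isZero_of_isSmonic_comp (hT : IsARTriangle J T) (hu : ¬ IsSmonic T.mor₁) {S : Cplx R}
    (ι : S ⟶ T.obj₁) (h : IsSmonic (ι ≫ T.mor₁)) (n : ℤ) : IsZero (S.X n) := by
  obtain ⟨D, e, he⟩ := h.exists_subDecomp
  obtain ⟨-, h₂, h₃⟩ := D.isMinimalOn_data hT.mem₂
  -- `D.data.cplxW` is the degreewise quotient of `Y` by `S`. Up to homotopy `v` kills `S` and
  -- factors through it, so irreducibility of `v` applies.
  obtain ⟨q, hq⟩ := Triangle.yoneda_exact₂ _ D.data.dist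
    ((Q R).map D.iso.inv ≫ (Q R).map T.mor₂) (by
      have h1 : D.data.u ≫ D.iso.inv = e.inv ≫ ι ≫ T.mor₁ := by
        rw [Iso.comp_inv_eq, Category.assoc, he, Iso.inv_hom_id_assoc]
      change (Q R).map D.data.u ≫ (Q R).map D.iso.inv ≫ (Q R).map T.mor₂ = 0
      rw [← Functor.map_comp_assoc, h1, Functor.map_comp, Functor.map_comp, Category.assoc,
        Category.assoc, hT.comp_zero₁₂, comp_zero, comp_zero])
  obtain ⟨q, rfl⟩ := (Q R).map_surjective (X := D.data.cplxW) (Y := T.obj₃) q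
  have hq' : (Q R).map ((D.iso.hom ≫ D.data.v) ≫ q) = (Q R).map T.mor₂ := by
    have : (Q R).map D.iso.inv ≫ (Q R).map T.mor₂ = (Q R).map D.data.v ≫ (Q R).map q := hq
    rw [Functor.map_comp, Functor.map_comp, Category.assoc, ← this, ← Functor.map_comp_assoc,
      Iso.hom_inv_id, CategoryTheory.Functor.map_id, Category.id_comp]
  rcases hT.isSmonic_or_isSepic h₃ _ q hq' with hp | hp
  -- If the quotient map is smonic, the composite from `S` to the quotient is both zero and smonic.
  · have h0 : (e.hom ≫ D.data.u) ≫ D.iso.inv ≫ D.iso.hom ≫ D.data.v = 0 := by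
      rw [Iso.inv_hom_id_assoc, Category.assoc, D.data.u_v, comp_zero]
    rw [← he, Category.assoc, Iso.hom_inv_id_assoc] at h0
    have hs := isSplitMono_comp _ _ (h n) (hp n)
    have : ((ι ≫ T.mor₁) ≫ D.iso.hom ≫ D.data.v).f n = 0 := by rw [h0]; rfl
    rw [HomologicalComplex.comp_f] at this
    rw [this] at hs
    rw [IsZero.iff_id_eq_zero, ← IsSplitMono.id (0 : S.X n ⟶ D.data.cplxW.X n), zero_comp]
  · exfalso
    -- Otherwise `v` is homotopic to a composite of sepic maps, so it is sepic and `u` is smonic.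
    apply hu
    apply hT.isSmonic_of_isSepic
    intro n
    refine isSplitEpi_of_map_eq hT.mem₂.isMinimal hT.mem₃.isMinimal hq' ?_
    have h1 : IsSplitEpi (D.data.v.f n) :=
      inferInstanceAs (IsSplitEpi (biprod.snd : D.A n ⊞ D.C n ⟶ D.C n))
    exact isSplitEpi_comp _ _ (isSplitEpi_comp _ _ inferInstance h1) (hp n)

end IsARTriangle

/-! ## Interpolation between the source and the target of a chain map -/

/-- A factorization of one component of a chain map extends to a factorization of the chain map
through a complex that agrees with the source below and with the target above that degree. -/
lemma exists_interpolation {Y Z : Cplx R} (v : Y ⟶ Z) (j : ℤ) {W : Proj R} (g : Y.X j ⟶ W)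
    (h : W ⟶ Z.X j) (hgh : g ≫ h = v.f j) :
    ∃ (V : Cplx R) (p : Y ⟶ V) (q : V ⟶ Z) (e : V.X j ≅ W), p ≫ q = v ∧
      (∀ m < j, IsIso (p.f m)) ∧ (∀ m, j < m → IsIso (q.f m)) ∧ p.f j ≫ e.hom = g ∧
      e.hom ≫ h = q.f j ∧ (IsMinimal Y → IsMinimal Z → IsMinimal V) := by
  have H : ∀ n, ∃ (W' : Proj R) (g' : Y.X n ⟶ W') (h' : W' ⟶ Z.X n), g' ≫ h' = v.f n ∧
      (n < j → IsIso g') ∧ (j < n → IsIso h') ∧ ∀ hn : n = j, ∃ e : W' ≅ W,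
        g' ≫ e.hom = eqToHom (by rw [hn]) ≫ g ∧ e.hom ≫ h = h' ≫ eqToHom (by rw [hn]) := by
    intro n
    rcases lt_trichotomy n j with hn | rfl | hn
    · exact ⟨Y.X n, 𝟙 _, v.f n, Category.id_comp _, fun _ => inferInstance,
        fun h => absurd h hn.asymm, fun h => absurd h hn.ne⟩
    · exact ⟨W, g, h, hgh, fun h => absurd h (lt_irrefl _), fun h => absurd h (lt_irrefl _),
        fun _ => ⟨Iso.refl _, by simp, by simp⟩⟩
    · exact ⟨Z.X n, v.f n, 𝟙 _, Category.comp_id _, fun h => absurd h hn.asymm,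
        fun _ => inferInstance, fun h => absurd h hn.ne'⟩
  choose W' g' h' hv hg hh he using H
  -- For `n < j` the differential is forced by invertibility of `g' n`, for `n ≥ j` by that of `h'
  -- (n + 1)`.
  have Hd : ∀ n, ∃ d : W' n ⟶ W' (n + 1), g' n ≫ d = Y.d n (n + 1) ≫ g' (n + 1) ∧
      d ≫ h' (n + 1) = h' n ≫ Z.d n (n + 1) := by
    intro n
    rcases lt_or_ge n j with hn | hn
    · have := hg n hn
      refine ⟨inv (g' n) ≫ Y.d n (n + 1) ≫ g' (n + 1), by simp, ?_⟩
      rw [Category.assoc, Category.assoc, hv, ← v.comm, ← hv, IsIso.inv_comp_eq, Category.assoc]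
    · have := hh (n + 1) (by lia)
      refine ⟨h' n ≫ Z.d n (n + 1) ≫ inv (h' (n + 1)), ?_, by simp⟩
      rw [reassoc_of% (hv n), v.comm_assoc, ← hv, Category.assoc, IsIso.hom_inv_id,
        Category.comp_id]
  choose d hd₁ hd₂ using Hd
  have sq : ∀ n, d n ≫ d (n + 1) = 0 := by
    intro n
    rcases lt_or_ge n j with hn | hn
    · have := hg n hn
      rw [← cancel_epi (g' n), reassoc_of% (hd₁ n), hd₁]
      simp
    · have := hh (n + 1 + 1) (by lia)
      rw [← cancel_mono (h' (n + 1 + 1)), Category.assoc, hd₂, reassoc_of% (hd₂ n)]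
      simp
  let V : Cplx R := CochainComplex.of W' d sq
  have hV : ∀ n, V.d n (n + 1) = d n := fun n => CochainComplex.of_d W' d n
  obtain ⟨e, he₁, he₂⟩ := he j rfl
  refine ⟨V, CochainComplex.ofHom g' fun n => ?_, CochainComplex.ofHom h' fun n => ?_, e, ?_,
    hg, hh, ?_, ?_, fun hY hZ i k => ?_⟩
  · rw [hV]
    exact hd₁ n
  · rw [hV]
    exact (hd₂ n).symm
  · ext1 n
    exact hv n
  · exact he₁.trans (by simp)
  · exact he₂.trans (by simp)
  · by_cases hik : i + 1 = k
    · subst hik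
      rw [hV]
      rcases lt_or_ge i j with hn | hn
      · have := hg i hn
        rw [← IsIso.inv_hom_id_assoc (g' i) (d i), hd₁]
        exact ((hY _ _).comp_right _).comp_left _
      · have := hh (i + 1) (by lia)
        rw [← Category.comp_id (d i), ← IsIso.hom_inv_id (h' (i + 1)), reassoc_of% (hd₂ i)]
        exact ((hZ _ _).comp_right _).comp_left _
    · rw [V.shape i k hik]
      exact IsRad.zero

open ZeroObject in
/-- The complex that agrees with a given complex above a degree and vanishes below it, with a
prescribed morphism in that degree. -/
lemma exists_truncation (X : Cplx R) (j : ℤ) {W : Proj R} (h : W ⟶ X.X j) :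
    ∃ (V : Cplx R) (q : V ⟶ X) (e : V.X j ≅ W), (∀ m < j, IsZero (V.X m)) ∧
      (∀ m, j < m → IsIso (q.f m)) ∧ e.hom ≫ h = q.f j ∧ (IsMinimal X → IsMinimal V) := by
  have hz : ∀ n, IsZero ((0 : Cplx R).X n) := isZero_cells_of_isZero (isZero_zero _)
  -- A truncation is an interpolation of the zero map from the zero complex.
  obtain ⟨V, p, q, e, -, h₁, h₂, -, h₄, h₅⟩ :=
    exists_interpolation (0 : (0 : Cplx R) ⟶ X) j 0 h zero_comp
  refine ⟨V, q, e, fun m hm => ?_, h₂, h₄, fun hX => h₅ (fun i k => ?_) hX⟩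
  · have := h₁ m hm
    exact (hz m).of_iso (asIso (p.f m)).symm
  · rw [(hz i).eq_of_src ((0 : Cplx R).d i k) 0]
    exact IsRad.zero

namespace IsARTriangle

variable {J : Set ℤ} {T T' : Triangle (Cplx R)} [IsArtinianRing R]

/-- The components of the second morphism have the factorization property of irreducible
morphisms. -/
lemma component_factor (hT : IsARTriangle J T) (j : ℤ) {W : Proj R} (g : T.obj₂.X j ⟶ W)
    (h : W ⟶ T.obj₃.X j) (hgh : g ≫ h = T.mor₂.f j) :
    (IsSplitMono g ∧ ∀ n, j < n → IsSplitMono (T.mor₂.f n)) ∨ IsSplitEpi h ∨ j ∉ J := by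
  -- For `j ∉ J` a nonzero `W` would take the interpolating complex out of the category.
  by_cases hj : j ∈ J
  · obtain ⟨V, p, q, e, h₁, h₂, h₃, h₄, h₅, h₆⟩ := exists_interpolation T.mor₂ j g h hgh
    have hV : IsMinimalOn J V := (h₆ hT.mem₂.isMinimal hT.mem₃.isMinimal).isMinimalOn (by
      intro n hn
      rcases lt_trichotomy n j with hnj | rfl | hnj
      · have := h₂ n hnj
        exact (hT.mem₂.isZero n hn).of_iso (asIso (p.f n)).symm
      · exact absurd hj hn
      · have := h₃ n hnj
        exact (hT.mem₃.isZero n hn).of_iso (asIso (q.f n)))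
    rcases hT.isSmonic_or_isSepic hV p q (by rw [h₁]) with hp | hq
    · refine Or.inl ⟨?_, fun n hn => ?_⟩
      · rw [← h₄]
        exact isSplitMono_comp _ _ (hp j) inferInstance
      · rw [← h₁, HomologicalComplex.comp_f]
        have := h₃ n hn
        exact isSplitMono_comp _ _ (hp n) inferInstance
    · have := hq j
      rw [← h₅] at this
      exact Or.inr (Or.inl (isSplitEpi_of_comp _ _ this))
  · exact Or.inr (Or.inr hj)

/-- A component of the second morphism that does not split is irreducible. -/
lemma isIrreducibleMor (hT : IsARTriangle J T) (j : ℤ) (h₁ : ¬ IsSplitMono (T.mor₂.f j))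
    (h₂ : ¬ IsSplitEpi (T.mor₂.f j)) : IsIrreducibleMor (T.mor₂.f j) := by
  refine ⟨h₁, h₂, fun W g h hgh => ?_⟩
  rcases hT.component_factor j g h hgh with h | h | h
  · exact Or.inl h.1
  · exact Or.inr h
  · exact Or.inl (isSplitMono_of_isZero _ (hT.mem₂.isZero j h))

/-- Above a component that is not a split epimorphism, all components of the second morphism are
split monomorphisms. -/
lemma isSplitMono_of_lt (hT : IsARTriangle J T) {j n : ℤ} (hj : ¬ IsSplitEpi (T.mor₂.f j))
    (hn : j < n) : IsSplitMono (T.mor₂.f n) := by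
  -- The factorization is trivial in degree `j`; the information lies in the higher degrees.
  rcases hT.component_factor j (𝟙 _) (T.mor₂.f j) (Category.id_comp _) with h | h | h
  · exact h.2 n hn
  · exact absurd h hj
  · exact absurd (isSplitEpi_of_isZero _ (hT.mem₃.isZero j h)) hj

/-- Above a nonzero cell of the third object, all components of the second morphism are split
epimorphisms. -/
lemma isSplitEpi_of_lt (hT : IsARTriangle J T) {m n : ℤ} (hm : ¬ IsZero (T.obj₃.X m))
    (hn : m < n) : IsSplitEpi (T.mor₂.f n) := by
  -- The truncation to degrees at least `n` misses the cell `m`, so it is not a split epimorphism;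
  -- its lift through `v` splits `v` in degree `n`.
  obtain ⟨V, q, e, h₁, h₂, h₃, h₄⟩ := exists_truncation T.obj₃ n (𝟙 (T.obj₃.X n))
  have hqn : IsIso (q.f n) := by
    rw [← h₃, Category.comp_id]
    infer_instance
  have hV : IsMinimalOn J V := (h₄ hT.mem₃.isMinimal).isMinimalOn (by
    intro k hk
    rcases lt_trichotomy k n with hkn | rfl | hkn
    · exact h₁ k hkn
    · exact (hT.mem₃.isZero k hk).of_iso (asIso (q.f k))
    · have := h₂ k hkn
      exact (hT.mem₃.isZero k hk).of_iso (asIso (q.f k)))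
  obtain ⟨t, ht⟩ := hT.exists_lift V hV ((Q R).map q) (fun hs => hm (by
    have := isSepic_of_isSplitEpi hT.mem₃.isMinimal hs m
    rw [(h₁ m hn).eq_of_src (q.f m) 0] at this
    rw [IsZero.iff_id_eq_zero, ← IsSplitEpi.id (0 : V.X m ⟶ T.obj₃.X m), comp_zero]))
  obtain ⟨t, rfl⟩ := (Q R).map_surjective t
  rw [← Functor.map_comp] at ht
  exact isSplitEpi_of_comp _ _
    (isSplitEpi_of_map_eq hV.isMinimal hT.mem₃.isMinimal ht.symm (n := n) inferInstance)

/-- If the first morphism is not smonic but its components in degrees above `i` are split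
monomorphisms, then the first object vanishes above `i` and the component in degree `i` is
radical. -/
lemma isZero_and_isRad (hT : IsARTriangle J T) {i : ℤ} (hi : ¬ IsSplitMono (T.mor₁.f i))
    (h : ∀ n, i < n → IsSplitMono (T.mor₁.f n)) :
    (∀ n, i < n → IsZero (T.obj₁.X n)) ∧ IsRad (T.mor₁.f i) := by
  have hu : ¬ IsSmonic T.mor₁ := fun h => hi (h i)
  have hz : ∀ n, i < n → IsZero (T.obj₁.X n) := by
    -- The part of `X` above degree `i` is smonic over `Y`, hence zero.
    obtain ⟨V, q, e, h₁, h₂, h₃, -⟩ := exists_truncation T.obj₁ (i + 1) (𝟙 (T.obj₁.X (i + 1)))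
    have hq : ∀ n, i < n → IsIso (q.f n) := by
      intro n hn
      rcases (show i + 1 ≤ n by lia).eq_or_lt with rfl | hn'
      · rw [← h₃, Category.comp_id]
        infer_instance
      · exact h₂ n hn'
    intro n hn
    have := hq n hn
    refine (hT.isZero_of_isSmonic_comp hu q (fun m => ?_) n).of_iso (asIso (q.f n)).symm
    rcases lt_or_ge i m with hm | hm
    · have := hq m hm
      exact isSplitMono_comp _ _ inferInstance (h m hm)
    · exact isSplitMono_of_isZero _ (h₁ m (by lia))
  -- Now `M`, placed in degree `i`, is itself a complex over `X` that is smonic over `Y`.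
  refine ⟨hz, isRad_of_forall_isZero _ fun M m hm => ?_⟩
  obtain ⟨V, q, e, h₁, h₂, h₃, -⟩ := exists_truncation T.obj₁ i m
  refine (hT.isZero_of_isSmonic_comp hu q (fun n => ?_) i).of_iso e.symm
  rcases lt_trichotomy n i with hn | rfl | hn
  · exact isSplitMono_of_isZero _ (h₁ n hn)
  · rw [HomologicalComplex.comp_f, ← h₃, Category.assoc]
    exact isSplitMono_comp _ _ inferInstance hm
  · have := h₂ n hn
    exact isSplitMono_of_isZero _ ((hz n hn).of_iso (asIso (q.f n)))

end IsARTriangle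

/-! ## Semisimple factors -/

/-- If a maximal left ideal `L` missed `x`, it would contain some `1 - s x`, which has left inverse
`1 + s x`. -/
lemma mem_jacobson_of_sq {x : R} (h : ∀ s : R, (s * x) * (s * x) = 0) :
    x ∈ Module.jacobson R R := by
  refine Submodule.mem_sInf.2 fun L hL => ?_
  by_contra hx
  have htop : L ⊔ Submodule.span R {x} = ⊤ := by
    refine hL.2 _ (lt_of_le_of_ne le_sup_left fun he => hx ?_)
    rw [he]
    exact Submodule.mem_sup_right (Submodule.mem_span_singleton_self x)
  obtain ⟨l, hl, m, hm, hlm⟩ := Submodule.mem_sup.1 (htop ▸ Submodule.mem_top : (1 : R) ∈ _)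
  obtain ⟨s, rfl⟩ := Submodule.mem_span_singleton.1 hm
  apply hL.1
  rw [Ideal.eq_top_iff_one]
  have h1 : (1 + s * x) * l = 1 := by
    rw [eq_sub_of_add_eq hlm, smul_eq_mul, mul_sub, mul_one, add_mul, one_mul, h s, add_zero,
      add_sub_cancel_right]
  rw [← h1]
  exact L.smul_mem _ hl

/-- Pull back a complement from the semisimple quotient by the radical. -/
lemma exists_isCompl_of_disjoint_jacobson [IsArtinianRing R] {S : Submodule R R}
    (h : Disjoint S (Module.jacobson R R)) : ∃ T : Submodule R R, IsCompl S T := by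
  set I := Module.jacobson R R
  have : IsSemisimpleModule R (R ⧸ I) :=
    (IsArtinian.isSemisimpleModule_iff_jacobson R (R ⧸ I)).2 (Module.jacobson_quotient_jacobson R R)
  obtain ⟨T, hT⟩ := exists_isCompl (S.map I.mkQ)
  refine ⟨T.comap I.mkQ, ?_, ?_⟩
  · rw [Submodule.disjoint_def] at h ⊢
    intro x hx hxT
    have h0 := Submodule.disjoint_def.1 hT.1 _ (Submodule.mem_map_of_mem hx) hxT
    exact h x hx ((Submodule.Quotient.mk_eq_zero I).1 h0)
  · rw [codisjoint_iff, eq_top_iff]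
    intro x _
    obtain ⟨y, ⟨s, hs, rfl⟩, t, ht, hst⟩ := Submodule.mem_sup.1
      (hT.sup_eq_top ▸ Submodule.mem_top : I.mkQ x ∈ _)
    refine Submodule.mem_sup.2 ⟨s, hs, x - s, ?_, by simp⟩
    rw [Submodule.mem_comap, map_sub, ← hst, add_sub_cancel_left]
    exact ht

/-- A two-sided ideal that is semisimple as a module and meets the radical trivially is a direct
factor of the ring. -/
lemma hasSemisimpleFactor_of_ideal [IsArtinianRing R] (S : Ideal R) [S.IsTwoSided]
    [IsSemisimpleModule R S] (h0 : S ≠ ⊥) (h : Disjoint S (Module.jacobson R R)) :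
    HasSemisimpleFactor R := by
  obtain ⟨T, hT⟩ := exists_isCompl_of_disjoint_jacobson h
  obtain ⟨e, he, f, hf, hef⟩ := Submodule.mem_sup.1
    (hT.sup_eq_top ▸ Submodule.mem_top : (1 : R) ∈ _)
  have hx : ∀ x ∈ S, x * e = x := by
    intro x hx
    have h1 : x * f = 0 := by
      refine Submodule.disjoint_def.1 hT.1 _ ?_ (T.smul_mem x hf)
      have h2 : x * f = x - x * e := by rw [eq_sub_iff_add_eq', ← mul_add, hef, mul_one]
      rw [h2]
      exact S.sub_mem hx (S.smul_mem x he)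
    have := mul_add x e f
    rw [hef, h1, mul_one, add_zero] at this
    exact this.symm
  have hr : ∀ r, e * r * e = e * r := fun r => hx _ (S.mul_mem_right r he)
  -- Since `e s (1 - e) = 0`, every left multiple of `(1 - e) r e` has square zero. So this element
  -- lies in the radical and in `S`, hence vanishes; with `hr` this makes `e` central.
  have hrr : ∀ r, r * e = e * r * e := by
    intro r
    have hy : r * e - e * r * e ∈ S ⊓ Module.jacobson R R := by
      refine ⟨S.sub_mem (S.smul_mem _ he) (S.smul_mem _ he), mem_jacobson_of_sq fun s => ?_⟩
      have h1 : e * (s * (r * e - e * r * e)) = 0 := by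
        have h2 := hr (s * (1 - e) * r)
        have h3 : e * s * (1 - e) = 0 := by rw [mul_sub, mul_one, hr, sub_self]
        have h4 : r * e - e * r * e = (1 - e) * r * e := by noncomm_ring
        rw [h4]
        calc e * (s * ((1 - e) * r * e)) = (e * s * (1 - e)) * (r * e) := by
              simp only [mul_assoc]
          _ = 0 := by rw [h3, zero_mul]
      have h5 : s * (r * e - e * r * e) = s * (r - e * r) * e := by noncomm_ring
      calc s * (r * e - e * r * e) * (s * (r * e - e * r * e))
          = (s * (r - e * r)) * (e * (s * (r * e - e * r * e))) := by
            nth_rewrite 1 [h5]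
            rw [mul_assoc]
        _ = 0 := by rw [h1, mul_zero]
    rw [disjoint_iff.1 h] at hy
    exact sub_eq_zero.1 hy
  have hspan : Ideal.span {e} = S := by
    refine le_antisymm ((Ideal.span_singleton_le_iff_mem S).2 he) fun x hx' => ?_
    exact Ideal.mem_span_singleton'.2 ⟨x, hx x hx'⟩
  refine ⟨e, ?_, hx e he, Subring.mem_center_iff.2 fun r => by rw [hrr, hr], ?_⟩
  · rintro rfl
    exact h0 (by rw [← hspan]; simp)
  · rw [hspan]
    infer_instance

/-- A nonzero projective module `P` for which all morphisms to `P` that are not split epimorphisms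
and all radical morphisms from `P` vanish gives rise to a semisimple factor of the ring. -/
lemma hasSemisimpleFactor_of [IsArtinianRing R] (P : Proj R) (hP : ¬ IsZero P)
    (h₁ : ∀ (M : Proj R) (q : M ⟶ P), ¬ IsSplitEpi q → q = 0)
    (h₂ : ∀ (M : Proj R) (φ : P ⟶ M), IsRad φ → φ = 0) : HasSemisimpleFactor R := by
  have hne : Nontrivial P.obj := by
    rw [isZero_iff_subsingleton, not_subsingleton_iff_nontrivial] at hP
    exact hP
  -- A nonzero map from the ring to `P` is a split epimorphism, so `P` is simple.
  have hsurj : ∀ x : P.obj, x ≠ 0 → Function.Surjective (LinearMap.toSpanSingleton R P.obj x) := by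
    intro x hx
    let q : Proj.of R ⟶ P := ofLin (LinearMap.toSpanSingleton R P.obj x)
    have hq : IsSplitEpi q := by
      by_contra hq
      have h0 : lin q (1 : R) = 0 := by rw [h₁ _ q hq]; rfl
      exact hx ((one_smul R x).symm.trans h0)
    intro y
    exact ⟨lin (section_ q) y, LinearMap.congr_fun (congrArg lin (IsSplitEpi.id q)) y⟩
  have hsimple : IsSimpleModule R P.obj :=
    isSimpleModule_iff_toSpanSingleton_surjective.2 ⟨hne, hsurj⟩
  obtain ⟨x, hx⟩ := exists_ne (0 : P.obj)
  obtain ⟨g, hg⟩ := Module.projective_lifting_property _ LinearMap.id (hsurj x hx)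
  have hgi : Function.Injective g := fun a b hab => by
    have := congrArg (LinearMap.toSpanSingleton R P.obj x) hab
    rwa [← LinearMap.comp_apply, ← LinearMap.comp_apply, hg] at this
  have : Ideal.IsTwoSided (isotypicComponent R R P.obj) :=
    isFullyInvariant_iff_isTwoSided.1 (Submodule.IsFullyInvariant.isotypicComponent R R P.obj)
  refine hasSemisimpleFactor_of_ideal (isotypicComponent R R P.obj) (fun hbot => ?_) ?_
  · have hle : LinearMap.range g ≤ isotypicComponent R R P.obj :=
      le_sSup ⟨(LinearEquiv.ofInjective g hgi).symm⟩
    rw [hbot, le_bot_iff, LinearMap.range_eq_bot] at hle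
    rw [hle] at hgi
    exact hx (hgi rfl)
  · rw [disjoint_iff]
    -- A simple submodule of the intersection is a copy of `P` and yields a nonzero radical map from
    -- `P` to the ring.
    by_contra hne
    obtain ⟨a, ha, hale⟩ := (IsAtomic.eq_bot_or_exists_atom_le
      (isotypicComponent R R P.obj ⊓ Module.jacobson R R)).resolve_left hne
    have : IsSimpleModule R a := isSimpleModule_iff_isAtom.2 ha
    obtain ⟨i⟩ := isIsotypicOfType_submodule_iff.1
      (IsIsotypicOfType.isotypicComponent R R P.obj) a (hale.trans inf_le_left)
    let φ : P ⟶ Proj.of R := ofLin (a.subtype ∘ₗ i.symm.toLinearMap)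
    have hφ : φ = 0 := h₂ _ φ (by
      rintro _ ⟨y, rfl⟩
      exact (hale.trans inf_le_right) (i.symm y).2)
    apply hx
    have h0 : ((i.symm x : a) : R) = 0 := LinearMap.congr_fun (congrArg lin hφ) x
    exact i.symm.map_eq_zero_iff.1 (Subtype.ext h0)

namespace IsARTriangle

variable {J : Set ℤ} {T : Triangle (Cplx R)} [IsArtinianRing R]

open HomologicalComplex in
/-- If the second object vanishes and the third one is concentrated in a degree `i` such that
`i + 1` belongs to `J`, then the ring has a semisimple factor. -/
lemma hasSemisimpleFactor (hT : IsARTriangle J T) {i : ℤ} (h₂ : ∀ n, IsZero (T.obj₂.X n))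
    (h₃ : ∀ n, n ≠ i → IsZero (T.obj₃.X n)) (hi : ¬ IsZero (T.obj₃.X i)) (hJ : i + 1 ∈ J) :
    HasSemisimpleFactor R := by
  have hiJ : i ∈ J := by
    by_contra h
    exact hi (hT.mem₃.isZero i h)
  have hz : IsZero ((Q R).obj T.obj₂) := (Q R).map_isZero (isZero_of_cells h₂)
  -- As `Y = 0`, lifting through `v` means vanishing.
  have hzero : ∀ (V : Cplx R), IsMinimalOn J V → ∀ q : V ⟶ T.obj₃, ¬ IsSplitEpi ((Q R).map q) →
      (Q R).map q = (Q R).map 0 := by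
    intro V hV q hq
    obtain ⟨t, ht⟩ := hT.exists_lift V hV _ hq
    rw [← ht, hz.eq_of_tgt t 0, zero_comp, Functor.map_zero]
  have hi1 : IsZero (T.obj₃.X (i - 1)) := h₃ _ (by lia)
  have hi2 : IsZero (T.obj₃.X (i + 1)) := h₃ _ (by lia)
  refine hasSemisimpleFactor_of (T.obj₃.X i) hi (fun M q hq => ?_) fun M φ hφ => ?_
  · obtain ⟨V, p, e, hV₁, hV₂, hp, hV₃⟩ := exists_truncation T.obj₃ i q
    have hVs : ∀ n, i < n → IsZero (V.X n) := fun n hn => by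
      have := hV₂ n hn
      exact (h₃ n hn.ne').of_iso (asIso (p.f n))
    have hV : IsMinimalOn J V := (hV₃ hT.mem₃.isMinimal).isMinimalOn fun k hk => by
      rcases lt_trichotomy k i with hki | rfl | hki
      · exact hV₁ k hki
      · exact absurd hiJ hk
      · exact hVs k hki
    have h0 := f_eq_of_map_eq (hzero V hV p fun hs => hq (by
      have := isSepic_of_isSplitEpi hT.mem₃.isMinimal hs i
      rw [← hp] at this
      exact isSplitEpi_of_comp _ _ this)) i (Or.inl (hVs _ (by lia))) (Or.inr hi1)
    rw [← hp, zero_f, ← cancel_epi e.inv, e.inv_hom_id_assoc, comp_zero] at h0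
    exact h0
  · by_contra hφ0
    have hrel : (ComplexShape.up ℤ).Rel i (i + 1) := rfl
    have hne : i ≠ i + 1 := by lia
    -- Test with the two-term complex `φ` in degrees `i` and `i + 1`, mapped to `Z` by the identity
    -- in degree `i`. A section would force `φ = 0`; otherwise the map is null-homotopic, so the
    -- identity of `Z^i` is radical and `Z^i = 0`.
    let V : Cplx R := double φ hrel
    let e₀ : V.X i ≅ T.obj₃.X i := doubleXIso₀ φ hrel
    let e₁ : V.X (i + 1) ≅ M := doubleXIso₁ φ hrel hne
    have hd : V.d i (i + 1) = e₀.hom ≫ φ ≫ e₁.inv := double_d φ hrel hne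
    have hV : IsMinimalOn J V := by
      refine IsMinimal.isMinimalOn (fun a b => ?_) fun k hk => ?_
      · by_cases ha : a = i
        · by_cases hb : b = i + 1
          · subst ha hb
            rw [hd]
            exact (hφ.comp_right _).comp_left _
          · rw [show V.d a b = 0 from double_d_eq_zero₁ φ hrel a b hb]
            exact IsRad.zero
        · rw [show V.d a b = 0 from double_d_eq_zero₀ φ hrel a b ha]
          exact IsRad.zero
      · exact isZero_double_X φ hrel k (fun h => hk (h ▸ hiJ)) (fun h => hk (h ▸ hJ))
    let q : V ⟶ T.obj₃ := mkHomFromDouble hrel hne (𝟙 _) 0 (by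
      rw [comp_zero]; exact hi2.eq_of_tgt _ _) (fun k hk => zero_comp)
    have hq : q.f i = e₀.hom := (mkHomFromDouble_f₀ hrel hne _ _ _ _).trans (Category.comp_id _)
    have h0 := isRad_sub_of_map_eq hV.isMinimal hT.mem₃.isMinimal (hzero V hV q fun hs => hφ0 (by
      obtain ⟨s, hs'⟩ := (Q R).map_surjective (section_ ((Q R).map q))
      have h1 : (Q R).map (s ≫ q) = (Q R).map (𝟙 _) := by simp [hs']
      have h2 := f_eq_of_map_eq h1 i (Or.inl hi2) (Or.inr hi1)
      rw [comp_f, hq, id_f] at h2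
      have h3 := s.comm i (i + 1)
      rw [hd, reassoc_of% h2, hi2.eq_of_src (s.f (i + 1)) 0, comp_zero,
        ← cancel_mono e₁.hom, Category.assoc, e₁.inv_hom_id, Category.comp_id, zero_comp] at h3
      exact h3)) i
    rw [hq, zero_f, sub_zero] at h0
    apply hi
    apply IsRad.isZero_of_id
    rw [← e₀.inv_hom_id]
    exact h0.comp_left _

end IsARTriangle

/-! ## The shape of the remaining Auslander-Reiten triangles -/

lemma IsRad.biprod_lift {M N P : Proj R} {f : M ⟶ N} {g : M ⟶ P} (hf : IsRad f) (hg : IsRad g) :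
    IsRad (biprod.lift f g) := by
  rw [biprod.lift_eq]
  exact (hf.comp_right _).add (hg.comp_right _)

lemma IsRad.biprod_desc {M N P : Proj R} {f : M ⟶ P} {g : N ⟶ P} (hf : IsRad f) (hg : IsRad g) :
    IsRad (biprod.desc f g) := by
  rw [biprod.desc_eq]
  exact (hf.comp_left _).add (hg.comp_left _)

lemma IsoInK.nonempty_iso₃ {T T' : Triangle (Cplx R)} [IsArtinianRing R]
    (h : IsoInK T T') (h₁ : IsMinimal T.obj₃) (h₂ : IsMinimal T'.obj₃) (n : ℤ) :
    Nonempty (T.obj₃.X n ≅ T'.obj₃.X n) := by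
  obtain ⟨e⟩ := h
  let e₃ : (Q R).obj T.obj₃ ≅ (Q R).obj T'.obj₃ := Triangle.π₃.mapIso e
  obtain ⟨f, hf⟩ := (Q R).map_surjective e₃.hom
  have : IsIso f := isIso_of_isIso_map h₁ h₂ (by rw [hf]; infer_instance)
  exact ⟨(HomologicalComplex.eval _ _ n).mapIso (asIso f)⟩

namespace MapDecomp

variable {X Y : Cplx R} {u : X ⟶ Y} (M : MapDecomp u)

lemma isRad_dX (hX : IsMinimal X) (n : ℤ) : IsRad (M.dX n) :=
  ((hX _ _).comp_right _).comp_left _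

lemma isRad_dY (hY : IsMinimal Y) (n : ℤ) : IsRad (M.dY n) :=
  ((hY _ _).comp_right _).comp_left _

lemma isRad_b (hX : IsMinimal X) (n : ℤ) : IsRad (M.data.b n) :=
  ((M.isRad_dX hX n).comp_right _).comp_left _

/-- The map `f` becomes an entry of the differential of the third complex, so it has to be radical.
-/
lemma isMinimal_cplxW (hX : IsMinimal X) (hY : IsMinimal Y) (hf : ∀ n, IsRad (M.f n)) :
    IsMinimal M.data.cplxW := by
  intro i j
  by_cases hij : i + 1 = j
  · subst hij
    rw [ConeData.cplxW_d]
    have he : IsRad (M.data.e (i + 1)) := ((M.isRad_dX hX _).comp_right _).comp_left _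
    have hβ : IsRad (M.data.β i) := ((M.isRad_dY hY _).comp_right _).comp_left _
    exact (he.neg.biprod_lift (hf (i + 1))).biprod_desc (hβ.comp_right _)
  · rw [M.data.cplxW.shape i j hij]
    exact IsRad.zero

open ZeroObject in
/-- A chain map has a standard form if its components are split epimorphisms in the degrees of a
lower set, and radical elsewhere. -/
lemma exists_of (u : X ⟶ Y) (S : Set ℤ) (hS : ∀ n, n + 1 ∈ S → n ∈ S)
    (h₁ : ∀ n ∈ S, IsSplitEpi (u.f n)) (h₂ : ∀ n ∉ S, IsRad (u.f n)) :
    ∃ M : MapDecomp u, (∀ n ∈ S, IsZero (M.B n)) ∧ (∀ n, IsRad (M.f n)) ∧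
      ∀ n ∉ S, IsIrreducibleMor (u.f n) → IsIrreducibleMor (M.f n) := by
  have H : ∀ n, ∃ (A E B : Proj R) (f : E ⟶ B) (a : X.X n ≅ A ⊞ E) (b : Y.X n ≅ A ⊞ B),
      u.f n ≫ b.hom = a.hom ≫ biprod.map (𝟙 _) f ∧ (n ∈ S → IsZero B) ∧ (n ∉ S → IsZero A) ∧
      IsRad f ∧ (n ∉ S → IsIrreducibleMor (u.f n) → IsIrreducibleMor f) := by
    intro n
    by_cases hn : n ∈ S
    · have := h₁ n hn
      obtain ⟨E, j, s, e₁, e₂, e₃, e₄⟩ :=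
        exists_complement (section_ (u.f n)) (u.f n) (IsSplitEpi.id _)
      refine ⟨Y.X n, E, 0, 0, biprodIso (IsSplitEpi.id _) e₁ e₂ e₃ e₄,
        isoBiprodZero (isZero_zero _), ?_, fun _ => isZero_zero _, fun h => absurd hn h,
        IsRad.zero, fun h => absurd hn h⟩
      apply biprod.hom_ext <;> simp
    · refine ⟨0, X.X n, Y.X n, u.f n, isoZeroBiprod (isZero_zero _), isoZeroBiprod (isZero_zero _),
        ?_, fun h => absurd h hn, fun _ => isZero_zero _, h₂ n hn, fun _ h => h⟩
      apply biprod.hom_ext <;> simp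
  choose A E B f a b hc hB hA hf hirr using H
  refine ⟨⟨A, E, B, f, a, b, hc, fun n => ?_⟩, hB, hf, hirr⟩
  -- `A (n + 1)` and `B n` could both be nonzero only for `n + 1 ∈ S` and `n ∉ S`, which a lower set
  -- excludes.
  by_cases hn : n + 1 ∈ S
  · exact Or.inl (hB n (hS n hn))
  · exact Or.inr (hA _ hn)

end MapDecomp

namespace ConeData

variable (D : ConeData (Proj R))

/-- The component is `b ⊞ 1`, and a radical split monomorphism has zero source. -/
lemma isSplitMono_v_iff [IsArtinianRing R] {n : ℤ} (hb : IsRad (D.b n)) :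
    IsSplitMono (D.v.f n) ↔ IsZero (D.A n) := by
  change IsSplitMono (biprod.map (D.b n) (𝟙 (D.B n))) ↔ _
  constructor
  · intro h
    have h1 := isSplitMono_comp (biprod.inl : D.A n ⟶ D.A n ⊞ D.B n) _ inferInstance h
    rw [biprod.inl_map] at h1
    exact hb.isZero_of_isSplitMono (isSplitMono_of_comp _ _ h1)
  · intro h
    refine ⟨⟨⟨biprod.map 0 (𝟙 _), ?_⟩⟩⟩
    apply biprod.hom_ext'
    · exact (h.eq_of_src _ _)
    · simp

lemma isSplitEpi_v_iff [IsArtinianRing R] {n : ℤ} (hb : IsRad (D.b n)) :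
    IsSplitEpi (D.v.f n) ↔ IsZero (D.E (n + 1)) := by
  change IsSplitEpi (biprod.map (D.b n) (𝟙 (D.B n))) ↔ _
  constructor
  · intro h
    have h1 := isSplitEpi_comp _ (biprod.fst : D.E (n + 1) ⊞ D.B n ⟶ D.E (n + 1)) h inferInstance
    rw [biprod.map_fst] at h1
    exact hb.isZero_of_isSplitEpi (isSplitEpi_of_comp _ _ h1)
  · intro h
    refine ⟨⟨⟨biprod.map 0 (𝟙 _), ?_⟩⟩⟩
    apply biprod.hom_ext
    · exact (h.eq_of_tgt _ _)
    · simp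

lemma isZero_cplxW {n : ℤ} (hE : IsZero (D.E (n + 1))) (hB : IsZero (D.B n)) :
    IsZero (D.cplxW.X n) :=
  (biprod_isZero_iff _ _).2 ⟨hE, hB⟩

lemma isIrreducibleMor_b {n : ℤ} (h : IsIrreducibleMor (D.v.f n)) (hB : IsZero (D.B n)) :
    IsIrreducibleMor (D.b n) := by
  change IsIrreducibleMor (biprod.map (D.b n) (𝟙 (D.B n))) at h
  have hfst : IsSplitMono (biprod.fst : D.A n ⊞ D.B n ⟶ D.A n) :=
    ⟨⟨⟨biprod.inl, by apply biprod.hom_ext; simp; exact hB.eq_of_tgt _ _⟩⟩⟩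
  have hinl : IsSplitEpi (biprod.inl : D.E (n + 1) ⟶ D.E (n + 1) ⊞ D.B n) :=
    ⟨⟨⟨biprod.fst, by apply biprod.hom_ext; simp; exact hB.eq_of_tgt _ _⟩⟩⟩
  have key : biprod.map (D.b n) (𝟙 (D.B n)) = biprod.fst ≫ D.b n ≫ biprod.inl := by
    apply biprod.hom_ext
    · simp
    · exact hB.eq_of_tgt _ _
  rw [key] at h
  refine ⟨fun hs => h.1 ?_, fun hs => h.2.1 ?_, fun W g k hgk => ?_⟩
  · exact isSplitMono_comp _ _ hfst (isSplitMono_comp _ _ hs inferInstance)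
  · exact isSplitEpi_comp _ _ inferInstance (isSplitEpi_comp _ _ hs hinl)
  · refine (h.2.2 W (biprod.fst ≫ g) (k ≫ biprod.inl) (by simp [reassoc_of% hgk])).imp
      (fun hs => ?_) (fun hs => ?_)
    · simpa using isSplitMono_comp (biprod.inl : D.A n ⟶ D.A n ⊞ D.B n) _ inferInstance hs
    · simpa using isSplitEpi_comp _ (biprod.fst : D.E (n + 1) ⊞ D.B n ⟶ _) hs inferInstance

/-- With `b = 0` the differential is diagonal and the complex is the sum of its `A` and `E` parts.
-/
lemma isZero_or_isZero {J : Set ℤ} (hI : IsIndecomposableOn J D.cplxX)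
    (hX : IsMinimalOn J D.cplxX) [IsArtinianRing R] (hb : ∀ n, D.b n = 0) :
    (∀ n, IsZero (D.A n)) ∨ (∀ n, IsZero (D.E n)) := by
  have hd : ∀ n, D.cplxX.d n (n + 1) =
      (biprod.desc (D.α n ≫ biprod.inl) (D.e n ≫ biprod.inr) :
        D.A n ⊞ D.E n ⟶ D.A (n + 1) ⊞ D.E (n + 1)) := fun n => by
    rw [cplxX_d, hb]
    apply biprod.hom_ext' <;> apply biprod.hom_ext <;> simp
  refine hI.cells_isZero hX D.A D.E (fun n => (biprod.inl : D.A n ⟶ D.A n ⊞ D.E n))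
    (fun n => (biprod.fst : D.A n ⊞ D.E n ⟶ D.A n)) (fun n => (biprod.inr : D.E n ⟶ D.A n ⊞ D.E n))
    (fun n => (biprod.snd : D.A n ⊞ D.E n ⟶ D.E n)) (fun n => biprod.inl_fst)
    (fun n => biprod.inr_snd) (fun n => biprod.inl_snd) (fun n => biprod.inr_fst)
    (fun n => biprod.total) (fun m n => ?_) (fun m n => ?_)
  · by_cases hmn : m + 1 = n
    · subst hmn
      rw [hd]
      have key : (biprod.inl : D.A m ⟶ D.A m ⊞ D.E m) ≫
          biprod.desc (D.α m ≫ biprod.inl) (D.e m ≫ biprod.inr) ≫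
          (biprod.snd : D.A (m + 1) ⊞ D.E (m + 1) ⟶ _) = 0 := by simp
      exact key
    · rw [D.cplxX.shape m n hmn]
      have key : biprod.inl ≫ (0 : D.A m ⊞ D.E m ⟶ D.A n ⊞ D.E n) ≫ biprod.snd = 0 := by simp
      exact key
  · by_cases hmn : m + 1 = n
    · subst hmn
      rw [hd]
      have key : (biprod.inr : D.E m ⟶ D.A m ⊞ D.E m) ≫
          biprod.desc (D.α m ≫ biprod.inl) (D.e m ≫ biprod.inr) ≫
          (biprod.fst : D.A (m + 1) ⊞ D.E (m + 1) ⟶ _) = 0 := by simp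
      exact key
    · rw [D.cplxX.shape m n hmn]
      have key : biprod.inr ≫ (0 : D.A m ⊞ D.E m ⟶ D.A n ⊞ D.E n) ≫ biprod.fst = 0 := by simp
      exact key

end ConeData

namespace IsARTriangle

variable {J : Set ℤ} {T T' : Triangle (Cplx R)} [IsArtinianRing R]

lemma isoOn (hT : IsARTriangle J T) (M : MapDecomp T.mor₁) (hf : ∀ n, IsRad (M.f n)) :
    IsoOn J T M.data.triangle := by
  have hiso : IsoInK T M.data.triangle :=
    isoInK_of_iso₁₂ hT.distinguished.mem M.data.dist M.iso₁ M.iso₂ M.comm_iso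
  have hW := M.isMinimal_cplxW hT.mem₁.isMinimal hT.mem₂.isMinimal hf
  refine ⟨(isMinimal_of_isIso hT.mem₁.isMinimal M.iso₁.hom).isMinimalOn fun n hn => ?_,
    (isMinimal_of_isIso hT.mem₂.isMinimal M.iso₂.hom).isMinimalOn fun n hn => ?_,
    hW.isMinimalOn fun n hn => ?_, hiso⟩
  · exact (hT.mem₁.isZero n hn).of_iso ((HomologicalComplex.eval _ _ n).mapIso M.iso₁.symm)
  · exact (hT.mem₂.isZero n hn).of_iso ((HomologicalComplex.eval _ _ n).mapIso M.iso₂.symm)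
  -- The shift of `E` could leave `J`; the support is instead inherited from `Z` by cellwise
  -- isomorphism.
  · obtain ⟨e⟩ := hiso.nonempty_iso₃ hT.mem₃.isMinimal hW n
    exact (hT.mem₃.isZero n hn).of_iso e.symm

lemma isSplit_mor₂_iff (hT : IsARTriangle J T) (h : IsoOn J T T') (n : ℤ) :
    (IsSplitMono (T.mor₂.f n) ↔ IsSplitMono (T'.mor₂.f n)) ∧
      (IsSplitEpi (T.mor₂.f n) ↔ IsSplitEpi (T'.mor₂.f n)) := by
  obtain ⟨-, h₂, h₃, ⟨i⟩⟩ := h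
  have H₁ := exists_isos_of_square hT.mem₂.isMinimal hT.mem₃.isMinimal h₂.isMinimal h₃.isMinimal
    T.mor₂ T'.mor₂ (Triangle.π₂.mapIso i) (Triangle.π₃.mapIso i) i.hom.comm₂ n
  have H₂ := exists_isos_of_square h₂.isMinimal h₃.isMinimal hT.mem₂.isMinimal hT.mem₃.isMinimal
    T'.mor₂ T.mor₂ (Triangle.π₂.mapIso i.symm) (Triangle.π₃.mapIso i.symm) i.symm.hom.comm₂ n
  exact ⟨⟨H₁.1, H₂.1⟩, ⟨H₁.2, H₂.2⟩⟩

/-- The common core of (b) and (c). A nonzero `E^(n+1)` makes `Z^n` nonzero, so `v` is a split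
epimorphism in all degrees above `n` and the higher pieces of `E` vanish; hence `E` has one nonzero
piece. If `A^i = 0`, then `b = 0` and indecomposability of `X` kills `A`; otherwise `v` does not
split in degree `i` and is irreducible there. -/
lemma of_mapDecomp (hT : IsARTriangle J T) (M : MapDecomp T.mor₁) (hf : ∀ n, IsRad (M.f n)) {i : ℤ}
    (hE : ¬ IsZero (M.E (i + 1))) (hB : IsZero (M.B i)) :
    (∀ n, n ≠ i + 1 → IsZero (M.E n)) ∧ (∀ n, i < n → IsZero (M.A n)) ∧
      (((∀ n, IsZero (M.A n)) ∧ IsSmonic T.mor₂) ∨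
        (IsSirreducible T.mor₂ ∧ IsIrreducibleMor (M.data.b i))) := by
  have hiso := hT.isoOn M hf
  have hD := hT.of_isoOn hiso
  have hm : ∀ n, IsSplitMono (T.mor₂.f n) ↔ IsZero (M.A n) := fun n =>
    (hT.isSplit_mor₂_iff hiso n).1.trans (M.data.isSplitMono_v_iff (M.isRad_b hT.mem₁.isMinimal n))
  have he : ∀ n, IsSplitEpi (T.mor₂.f n) ↔ IsZero (M.E (n + 1)) := fun n =>
    (hT.isSplit_mor₂_iff hiso n).2.trans (M.data.isSplitEpi_v_iff (M.isRad_b hT.mem₁.isMinimal n))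
  have hZ : ∀ n, ¬ IsZero (M.E (n + 1)) → ¬ IsZero (T.obj₃.X n) := by
    intro n hn hz
    exact hn ((he n).1 (isSplitEpi_of_isZero _ hz))
  have hEz : ∀ n, n ≠ i + 1 → IsZero (M.E n) := by
    intro n hn
    obtain ⟨n, rfl⟩ : ∃ m, n = m + 1 := ⟨n - 1, by simp⟩
    rcases lt_or_gt_of_ne (show n ≠ i by lia) with h | h
    · by_contra hc
      exact hE ((he i).1 (hT.isSplitEpi_of_lt (hZ n hc) h))
    · exact (he n).1 (hT.isSplitEpi_of_lt (hZ i hE) h)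
  have hi : ¬ IsSplitEpi (T.mor₂.f i) := fun h => hE ((he i).1 h)
  have hAz : ∀ n, i < n → IsZero (M.A n) := fun n hn => (hm n).1 (hT.isSplitMono_of_lt hi hn)
  refine ⟨hEz, hAz, ?_⟩
  by_cases hA : IsZero (M.A i)
  · left
    have hb : ∀ n, M.data.b n = 0 := by
      intro n
      by_cases hn : n = i
      · subst hn
        exact hA.eq_of_src _ _
      · exact (hEz (n + 1) (by lia)).eq_of_tgt _ _
    have h0 := (M.data.isZero_or_isZero hD.indecomposable₁ hD.mem₁ hb).resolve_right
      (fun h => hE (h _))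
    exact ⟨h0, fun n => (hm n).2 (h0 n)⟩
  · right
    have hi' : ¬ IsSplitMono (T.mor₂.f i) := fun h => hA ((hm i).1 h)
    have hlo : ∀ n, n < i → IsSplitEpi (T.mor₂.f n) := fun n hn => (he n).2 (hEz _ (by lia))
    have hhi : ∀ n, i < n → IsSplitMono (T.mor₂.f n) := fun n hn => (hm n).2 (hAz n hn)
    refine ⟨⟨i, hT.isIrreducibleMor i hi' hi, fun n hn => ?_, hlo, hhi⟩, ?_⟩
    · rcases lt_trichotomy n i with h | h | h
      · exact absurd (hlo n h) hn.2.1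
      · exact h
      · exact absurd (hhi n h) hn.1
    · refine M.data.isIrreducibleMor_b (hD.isIrreducibleMor i ?_ ?_) hB
      · exact fun h => hi' ((hT.isSplit_mor₂_iff hiso i).1.2 h)
      · exact fun h => hi ((hT.isSplit_mor₂_iff hiso i).2.2 h)

/-- If the first morphism is sepic, the second one is sirreducible, unless the second object
vanishes and the ring has a semisimple factor. -/
lemma of_isSepic (hT : IsARTriangle J T) (hu : IsSepic T.mor₁)
    (h : ¬ HasSemisimpleFactor R ∨ ¬ IsZero ((Q R).obj T.obj₂)) :
    IsSirreducible T.mor₂ ∧ HasShapeSepic J T := by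
  obtain ⟨M, hB, hf, -⟩ := MapDecomp.exists_of T.mor₁ Set.univ (fun _ _ => trivial)
    (fun n _ => hu n) (fun n hn => absurd trivial hn)
  have hB' : ∀ n, IsZero (M.B n) := fun n => hB n trivial
  have hiso := hT.isoOn M hf
  obtain ⟨i, hi⟩ : ∃ i, ¬ IsZero (M.E (i + 1)) := by
    by_contra! hc
    exact (hT.of_isoOn hiso).indecomposable₃.1
      ((Q R).map_isZero (isZero_of_cells fun n => M.data.isZero_cplxW (hc n) (hB' n)))
  obtain ⟨hE, hA, ⟨h0, -⟩ | ⟨hv, hb⟩⟩ := hT.of_mapDecomp M hf hi (hB' i)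
  · exfalso
    -- In this case `Y = 0`, while `X` and `Z` are concentrated in degrees `i + 1` and `i`.
    have h₂ : ∀ n, IsZero (T.obj₂.X n) := fun n =>
      ((biprod_isZero_iff _ _).2 ⟨h0 n, hB' n⟩).of_iso (M.isoY n)
    refine h.elim (fun h => h (hT.hasSemisimpleFactor (i := i) h₂ (fun n hn => ?_) (fun hz => ?_) ?_))
      (fun h => h ((Q R).map_isZero (isZero_of_cells h₂)))
    · obtain ⟨e⟩ := hiso.2.2.2.nonempty_iso₃ hT.mem₃.isMinimal hiso.2.2.1.isMinimal n
      exact (M.data.isZero_cplxW (hE _ (by lia)) (hB' n)).of_iso e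
    · obtain ⟨e⟩ := hiso.2.2.2.nonempty_iso₃ hT.mem₃.isMinimal hiso.2.2.1.isMinimal i
      have hz' : IsZero (M.E (i + 1) ⊞ M.B i) := hz.of_iso e.symm
      exact hi ((biprod_isZero_iff _ _).1 hz').1
    · by_contra hJ
      exact hi ((biprod_isZero_iff _ _).1
        ((hT.mem₁.isZero _ hJ).of_iso (M.isoX (i + 1)).symm)).2
  · exact ⟨hv, M.data, i, hA, fun n hn => hE n (by lia), hB', hb, hiso⟩

/-- If the first morphism is sirreducible, the second one is smonic or sirreducible. -/
lemma of_isSirreducible (hT : IsARTriangle J T) (hu : IsSirreducible T.mor₁) :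
    (IsSmonic T.mor₂ ∧ HasShapeSirreducible₁ J T) ∨
      (IsSirreducible T.mor₂ ∧ HasShapeSirreducible₃ J T) := by
  obtain ⟨i, hirr, -, hlo, hhi⟩ := hu
  -- The nonzero piece `E^(k+1)` governs `v` one degree lower, in degree `k`.
  obtain ⟨k, rfl⟩ : ∃ m, i = m + 1 := ⟨i - 1, by simp⟩
  obtain ⟨hX, hrad⟩ := hT.isZero_and_isRad hirr.1 hhi
  obtain ⟨M, hB, hf, hM⟩ := MapDecomp.exists_of T.mor₁ (Set.Iio (k + 1))
    (fun n hn => by simp only [Set.mem_Iio] at hn ⊢; lia) hlo (fun n hn => by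
      rcases (show k + 1 ≤ n from not_lt.1 hn).eq_or_lt with rfl | hn
      · exact hrad
      · rw [(hX n hn).eq_of_src (T.mor₁.f n) 0]
        exact IsRad.zero)
  have hfk := hM (k + 1) (lt_irrefl (k + 1)) hirr
  have hiso := hT.isoOn M hf
  obtain ⟨hE, hA, ⟨h0, hv⟩ | ⟨hv, hb⟩⟩ := hT.of_mapDecomp M hf
    (fun hz => hfk.1 (isSplitMono_of_isZero _ hz)) (hB k (by simp))
  · exact Or.inl ⟨hv, M.data, k + 1, h0, fun n hn => hE n hn.ne', hB, hfk, hiso⟩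
  · have hk : k + 1 - 1 = k := by lia
    refine Or.inr ⟨hv, M.data, k + 1, fun n hn => hA n (by lia), hE, hB, hfk, ?_, hiso⟩
    rw [hk]
    exact hb

end IsARTriangle

end ARTriangles

end

theorem theorem2 {k : Type*} [Field k] {Λ : Type u} [Ring Λ] [Algebra k Λ] [Module.Finite k Λ]
    (J : Set ℤ) (hJ : J.OrdConnected)
    (X Y Z : ARTriangles.Cplx Λᵐᵒᵖ) (u : X ⟶ Y) (v : Y ⟶ Z) (w : Z ⟶ X⟦(1 : ℤ)⟧)
    (hT : ARTriangles.IsARTriangle J (Triangle.mk u v w)) :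
    (ARTriangles.IsSmonic u →
      ARTriangles.IsSepic v ∧ ARTriangles.HasShapeSmonic J (Triangle.mk u v w)) ∧
    (ARTriangles.IsSepic u →
      (¬ ARTriangles.HasSemisimpleFactor Λᵐᵒᵖ ∨ ¬ IsZero ((ARTriangles.Q Λᵐᵒᵖ).obj Y)) →
      ARTriangles.IsSirreducible v ∧ ARTriangles.HasShapeSepic J (Triangle.mk u v w)) ∧
    (ARTriangles.IsSirreducible u →
      (ARTriangles.IsSmonic v ∧ ARTriangles.HasShapeSirreducible₁ J (Triangle.mk u v w)) ∨
      (ARTriangles.IsSirreducible v ∧ ARTriangles.HasShapeSirreducible₂ J (Triangle.mk u v w)) ∨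
      (ARTriangles.IsSirreducible v ∧
        ARTriangles.HasShapeSirreducible₃ J (Triangle.mk u v w))) := by
  -- Right `Λ`-modules are left modules over the opposite algebra, which is Artinian because it is
  -- finite-dimensional.
  have : Module.Finite k Λᵐᵒᵖ := Module.Finite.equiv (MulOpposite.opLinearEquiv k)
  have : IsArtinianRing Λᵐᵒᵖ := IsArtinianRing.of_finite k Λᵐᵒᵖ
  exact ⟨fun h => hT.of_isSmonic h, fun h h' => hT.of_isSepic h h',
    fun h => (hT.of_isSirreducible h).imp_right Or.inr⟩
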